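/- There are absolute constants $C>0$ and $c_0>0$ such that the following holds. Let $n,k,m$ be integers with $1\le k\le n$ and $m\ge C\,k\log(en/k)$, and let $x_0\in\mathbb{C}^n$ be $k$-sparse, i.e. $x_0$ has at most $k$ nonzero entries. Let $a_1,\dots,a_m$ be independent standard complex Gaussian random vectors in $\mathbb{C}^n$, i.e. each $a_j$ is distributed as $u+iv$ with $u,v$ independent real Gaussian vectors of law $\mathcal{N}(0,\tfrac12 I_n)$, and let $A=(a_1,\dots,a_m)^T\in\mathbb{C}^{m\times n}$ be the matrix with rows $a_j^T$. Then, with probability at least $1-2\exp(-c_0m)$, $$\operatorname*{argmin}_{x\in\mathbb{C}^n}\{\|x\|_1 : |Ax|=|Ax_0|\}=\{c\,x_0 : c\in\mathbb{C},\ |c|=1\},$$ where the modulus $|\cdot|$ of a vector is taken entrywise, $\|x\|_1=\sum_i|x_i|$, and argmin denotes the set of all minimizers. -/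

import Mathlib

open MeasureTheory ProbabilityTheory
open scoped Matrix

noncomputable section

/-- The law of the complex Gaussian random vector `u + v i`, where `u` and `v` are independent real
Gaussian random vectors with law `N(0, I/2)`. -/
def complexGaussian (n : ℕ) : Measure (Fin n → ℂ) :=
  ((Measure.pi fun _ : Fin n => gaussianReal 0 (1 / 2)).prod
    (Measure.pi fun _ : Fin n => gaussianReal 0 (1 / 2))).map
      fun p : (Fin n → ℝ) × (Fin n → ℝ) => fun i => (p.1 i : ℂ) + (p.2 i : ℂ) * Complex.I

/-- `x` has at most `k` nonzero entries. -/
def IsSparse {n : ℕ} (k : ℕ) (x : Fin n → ℂ) : Prop := hammingNorm x ≤ k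

/-- The norm `‖x‖₁`. -/
def l1Norm {n : ℕ} (x : Fin n → ℂ) : ℝ := ∑ i, ‖x i‖

/-- The vectors `x` with `|A x| = |A x₀|`, the modulus being taken entrywise. -/
def phaselessFeasible {m n : ℕ} (A : Matrix (Fin m) (Fin n) ℂ) (x₀ : Fin n → ℂ) :
    Set (Fin n → ℂ) :=
  {x | ∀ j, ‖(A *ᵥ x) j‖ = ‖(A *ᵥ x₀) j‖}

/-- The set of all minimizers of `‖x‖₁` subject to `|A x| = |A x₀|`. -/
def l1Minimizers {m n : ℕ} (A : Matrix (Fin m) (Fin n) ℂ) (x₀ : Fin n → ℂ) :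
    Set (Fin n → ℂ) :=
  {x | x ∈ phaselessFeasible A x₀ ∧ ∀ y ∈ phaselessFeasible A x₀, l1Norm x ≤ l1Norm y}

/-- The set `{c x₀ : c ∈ ℂ, |c| = 1}`. -/
def phaseOrbit {n : ℕ} (x₀ : Fin n → ℂ) : Set (Fin n → ℂ) :=
  {x | ∃ c : ℂ, ‖c‖ = 1 ∧ x = c • x₀}

end

/-!
Fix the sparse vector `x₀`. Recovery follows from two properties of the measurement map `A` on
vectors with at most a large constant multiple of `k` nonzero entries (`SeparatesSparse`):
`‖A x‖ ≤ κ ‖x‖`, and, whenever `⟪p, q⟫` is real,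
`c ‖p‖ ‖q‖ ≤ ∑ j, |Re (conj (A p)ⱼ (A q)ⱼ)|`. For `p = x - y` and `q = x + y` the sum on the right is
`∑ j, ||(A x)ⱼ|² - |(A y)ⱼ|²|`, so the second property says that intensities separate sparse vectors
up to a global phase.

Deterministic part (`SeparatesSparse.eq_of_aligned`). Let `x` have the intensities of `x₀` and
`‖x‖₁ ≤ ‖x₀‖₁`; after multiplication by a phase, `⟪x₀, x⟫ ≥ 0`. Let `x'` be `x` restricted to the
support `S` of `x₀` and to the `s` largest remaining coordinates, and `t = x - x'`. The `ℓ¹`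
inequality gives `∑ i ∉ S, |x i| ≤ √k ‖p‖` with `p = x' - x₀`, hence `‖A t‖ ≤ κ √(k / s) ‖p‖` by the
usual decomposition into blocks (`exists_block_norm_le`). As `|A x| = |A x₀|`, the intensities of
`x'` and `x₀` differ by at most `‖A t‖ ‖2 A x' + A t‖` in total, which for large `s / k` is smaller
than `c ‖p‖ ‖x' + x₀‖` unless `p = 0`; then `t = 0` as well.

Probabilistic part. For `p` and `q` in the unit ball with `|Im ⟪p, q⟫|` not too large, the variable
`Y = Re (conj (a ⬝ᵥ p) (a ⬝ᵥ q))` has second moment bounded below (computed by polarization from the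
fourth moments of `a ⬝ᵥ w`, `integral_re_conj_dotProduct_sq`) and fourth moment bounded above, so
that `E exp (-θ |Y|) < 1` for a small `θ` (`lintegral_lower_tail_le`). Chernoff's bound makes
`∑ j, |Yⱼ|` at least a constant multiple of `m` outside an event of probability `exp (-c m)`, and
similarly `∑ j, |aⱼ ⬝ᵥ p|²` is at most `8 m`. A union bound over the supports
(`card_supports_le`) and over nets of the corresponding unit balls (`exists_net_supported`) costs a
factor `exp (O (k log (e n / k)))`, which is absorbed by `m ≥ C k log (e n / k)`; the bounds on the
nets extend to all sparse vectors (`SeparatesSparse.of_nets`).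
-/

open scoped NNReal

/-! ### Moments of a centred real Gaussian variable -/


theorem integrable_pow_gaussianReal (v : ℝ≥0) (k : ℕ) :
    Integrable (fun x : ℝ => x ^ k) (gaussianReal 0 v) := by
  have h := memLp_id_gaussianReal (μ := 0) (v := v) (k : ℝ≥0)
  rcases Nat.eq_zero_or_pos k with rfl | hk
  · simp
  · have := h.integrable_norm_pow (by omega)
    rw [← integrable_norm_iff (by fun_prop)]
    simpa [norm_pow] using this

theorem integral_pow_four_gaussianReal (v : ℝ≥0) :
    ∫ x : ℝ, x ^ 4 ∂gaussianReal 0 v = 3 * (v : ℝ) ^ 2 := by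
  have h0 : (0 : ℝ) ∈ interior (integrableExpSet (fun x : ℝ => x) (gaussianReal 0 v)) := by simp
  have h := iteratedDeriv_mgf_zero h0 4
  have h' : ∫ x : ℝ, x ^ 4 ∂gaussianReal 0 v =
      (gaussianReal 0 v)[(fun x : ℝ => x) ^ 4] := by
    simp
  rw [h', ← h, mgf_fun_id_gaussianReal]
  have hd : ∀ t : ℝ, HasDerivAt (fun t : ℝ => Real.exp (0 * t + v * t ^ 2 / 2))
      (v * t * Real.exp (0 * t + v * t ^ 2 / 2)) t := fun t => by
    have : HasDerivAt (fun t : ℝ => 0 * t + v * t ^ 2 / 2) (v * t) t := by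
      refine (((hasDerivAt_id' t).const_mul (0 : ℝ)).fun_add
        ((((hasDerivAt_id' t).fun_pow 2).const_mul (v : ℝ)).div_const 2)).congr_deriv ?_
      ring
    convert this.exp using 1
    ring
  -- Differentiating `q t * exp (v t² / 2)` replaces the polynomial `q` by `q' + v t q`.
  have hmul : ∀ (q q' : ℝ → ℝ), (∀ t, HasDerivAt q (q' t) t) →
      deriv (fun t : ℝ => q t * Real.exp (0 * t + v * t ^ 2 / 2)) =
        fun t => (q' t + q t * (v * t)) * Real.exp (0 * t + v * t ^ 2 / 2) := by
    intro q q' hq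
    funext t
    rw [((hq t).fun_mul (hd t)).deriv]
    ring
  have e1 : deriv (fun t : ℝ => Real.exp (0 * t + v * t ^ 2 / 2)) =
      fun t => (v * t) * Real.exp (0 * t + v * t ^ 2 / 2) := funext fun t => (hd t).deriv
  have q1 : ∀ t : ℝ, HasDerivAt (fun t : ℝ => (v : ℝ) * t) v t := fun t => by
    simpa using (hasDerivAt_id' t).const_mul (v : ℝ)
  have q2 : ∀ t : ℝ, HasDerivAt (fun t : ℝ => (v : ℝ) + v * t * (v * t)) (2 * v ^ 2 * t) t :=
    fun t => by
      refine (((q1 t).fun_mul (q1 t)).const_add (v : ℝ)).congr_deriv ?_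
      ring
  have q3 : ∀ t : ℝ, HasDerivAt
      (fun t : ℝ => 2 * (v : ℝ) ^ 2 * t + (v + v * t * (v * t)) * (v * t))
      (3 * v ^ 2 + 3 * v ^ 3 * t ^ 2) t :=
    fun t => by
      refine (((hasDerivAt_id' t).const_mul (2 * (v : ℝ) ^ 2)).fun_add
        ((q2 t).fun_mul (q1 t))).congr_deriv ?_
      ring
  rw [iteratedDeriv_succ', iteratedDeriv_succ', iteratedDeriv_succ', iteratedDeriv_one, e1,
    hmul _ _ q1, hmul _ _ q2, hmul _ _ q3]
  simp

/-- For variance at most `1 / 2`, `exp (X² / 2)` has mean at most `√2 ≤ 2`. -/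
theorem integrable_exp_sq_gaussianReal {v : ℝ≥0} (hv : v ≤ 1 / 2) :
    Integrable (fun x : ℝ => Real.exp (x ^ 2 / 2)) (gaussianReal 0 v) ∧
      ∫ x : ℝ, Real.exp (x ^ 2 / 2) ∂gaussianReal 0 v ≤ 2 := by
  have hw : (1 / 2 : ℝ≥0) ≠ 0 := by norm_num
  have key : ∀ x : ℝ, gaussianPDFReal 0 (1 / 2) x * Real.exp (x ^ 2 / 2) =
      (Real.sqrt Real.pi)⁻¹ * Real.exp (-(1 / 2) * x ^ 2) := by
    intro x
    rw [gaussianPDFReal, mul_assoc, ← Real.exp_add]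
    push_cast
    rw [show 2 * Real.pi * (1 / 2) = Real.pi by ring,
      show -(x - 0) ^ 2 / (2 * (1 / 2)) + x ^ 2 / 2 = -(1 / 2) * x ^ 2 by ring]
  have i0 : Integrable (fun x : ℝ => Real.exp (x ^ 2 / 2)) (gaussianReal 0 (1 / 2)) := by
    rw [gaussianReal_of_var_ne_zero _ hw, gaussianPDF_def,
      integrable_withDensity_iff_integrable_smul₀' (by fun_prop) (by simp)]
    refine ((integrable_exp_neg_mul_sq (b := 1 / 2) (by norm_num)).const_mul
      (Real.sqrt Real.pi)⁻¹).congr (Filter.Eventually.of_forall fun x => ?_)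
    simp only [smul_eq_mul, ENNReal.toReal_ofReal (gaussianPDFReal_nonneg _ _ _)]
    rw [key]
  have v0 : ∫ x : ℝ, Real.exp (x ^ 2 / 2) ∂gaussianReal 0 (1 / 2) ≤ 2 := by
    rw [integral_gaussianReal_eq_integral_smul hw]
    simp only [smul_eq_mul, key]
    rw [integral_const_mul, integral_gaussian]
    rw [← Real.sqrt_inv, ← Real.sqrt_mul (by positivity)]
    rw [show Real.pi⁻¹ * (Real.pi / (1 / 2)) = 2 by field_simp]
    rw [Real.sqrt_le_left (by norm_num)]
    norm_num
  -- A variable of variance `v` is `√(2v)` times one of variance `1 / 2`.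
  set c : ℝ := Real.sqrt (2 * v) with hc
  have hc2 : c ^ 2 = 2 * v := Real.sq_sqrt (by positivity)
  have hv' : (v : ℝ) ≤ 1 / 2 := by exact_mod_cast hv
  have hc1 : c ^ 2 ≤ 1 := by rw [hc2]; linarith
  have hmap : gaussianReal 0 v = (gaussianReal 0 (1 / 2)).map (fun x => c * x) := by
    rw [gaussianReal_map_const_mul]
    congr 1
    · simp
    · ext
      push_cast
      rw [hc2]; ring
  have hle : ∀ x : ℝ, Real.exp ((c * x) ^ 2 / 2) ≤ Real.exp (x ^ 2 / 2) := fun x => by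
    rw [Real.exp_le_exp, mul_pow]
    nlinarith [sq_nonneg x]
  have i1 : Integrable (fun x : ℝ => Real.exp ((c * x) ^ 2 / 2)) (gaussianReal 0 (1 / 2)) :=
    i0.mono' (by fun_prop) (Filter.Eventually.of_forall fun x => by
      rw [Real.norm_of_nonneg (Real.exp_pos _).le]; exact hle x)
  rw [hmap]
  constructor
  · rw [integrable_map_measure (by fun_prop) (by fun_prop)]
    exact i1
  · rw [integral_map (by fun_prop) (by fun_prop)]
    exact (integral_mono i1 i0 hle).trans v0

/-! ### Linear functionals of a complex Gaussian vector -/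

instance isProbabilityMeasure_complexGaussian (n : ℕ) :
    IsProbabilityMeasure (complexGaussian n) := by
  unfold complexGaussian
  exact Measure.isProbabilityMeasure_map (by fun_prop)

theorem re_dotProduct_eq {n : ℕ} (u v : Fin n → ℝ) (w : Fin n → ℂ) :
    ((fun i => (u i : ℂ) + (v i : ℂ) * Complex.I) ⬝ᵥ w).re =
      (∑ i, u i * (w i).re) + ∑ i, v i * (-(w i).im) := by
  simp [dotProduct, Finset.sum_add_distrib, sub_eq_add_neg]

/-- Real parts of linear functionals of a complex Gaussian vector are Gaussian; the variance is
`‖w‖² / 2`. The proof compares characteristic functions. -/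
theorem map_re_dotProduct_complexGaussian {n : ℕ} (w : EuclideanSpace ℂ (Fin n)) :
    (complexGaussian n).map (fun a => (a ⬝ᵥ w.ofLp).re) = gaussianReal 0 (‖w‖₊ ^ 2 / 2) := by
  have hm : Measurable fun a : Fin n → ℂ => (a ⬝ᵥ w.ofLp).re := by
    unfold dotProduct; fun_prop
  unfold complexGaussian
  rw [Measure.map_map hm (by fun_prop)]
  have : IsProbabilityMeasure ((((Measure.pi fun _ : Fin n => gaussianReal 0 (1 / 2)).prod
    (Measure.pi fun _ : Fin n => gaussianReal 0 (1 / 2)))).map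
      ((fun a : Fin n → ℂ => (a ⬝ᵥ w.ofLp).re) ∘ fun p : (Fin n → ℝ) × (Fin n → ℝ) =>
        fun i => (p.1 i : ℂ) + (p.2 i : ℂ) * Complex.I)) :=
    Measure.isProbabilityMeasure_map (hm.comp (by fun_prop)).aemeasurable
  apply Measure.ext_of_charFun
  funext t
  rw [charFun_apply_real, integral_map (hm.comp (by fun_prop)).aemeasurable
    (by fun_prop)]
  have hsplit : ∀ p : (Fin n → ℝ) × (Fin n → ℝ),
      Complex.exp (t * (((fun a : Fin n → ℂ => (a ⬝ᵥ w.ofLp).re) ∘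
        fun p : (Fin n → ℝ) × (Fin n → ℝ) =>
          fun i => (p.1 i : ℂ) + (p.2 i : ℂ) * Complex.I) p : ℝ) * Complex.I) =
      (∏ i, Complex.exp (((t * (w i).re : ℝ) : ℂ) * (p.1 i : ℝ) * Complex.I)) *
        ∏ i, Complex.exp (((t * -(w i).im : ℝ) : ℂ) * (p.2 i : ℝ) * Complex.I) := by
    intro p
    rw [Function.comp_apply, re_dotProduct_eq, ← Complex.exp_sum, ← Complex.exp_sum,
      ← Complex.exp_add]
    congr 1
    push_cast
    rw [← Finset.sum_mul, ← Finset.sum_mul, ← add_mul]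
    congr 1
    rw [mul_add, Finset.mul_sum, Finset.mul_sum]
    congr 1 <;> exact Finset.sum_congr rfl fun i _ => by ring
  simp_rw [hsplit]
  rw [integral_prod_mul
    (fun u : Fin n → ℝ => ∏ i, Complex.exp (((t * (w i).re : ℝ) : ℂ) * (u i : ℝ) * Complex.I))
    (fun v : Fin n → ℝ => ∏ i, Complex.exp (((t * -(w i).im : ℝ) : ℂ) * (v i : ℝ) * Complex.I))]
  rw [integral_fintype_prod_eq_prod
      (fun i (x : ℝ) => Complex.exp (((t * (w i).re : ℝ) : ℂ) * x * Complex.I)),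
    integral_fintype_prod_eq_prod
      (fun i (x : ℝ) => Complex.exp (((t * -(w i).im : ℝ) : ℂ) * x * Complex.I))]
  simp_rw [← charFun_apply_real, charFun_gaussianReal]
  rw [← Complex.exp_sum, ← Complex.exp_sum, ← Complex.exp_add]
  congr 1
  have hn : (((‖w‖₊ ^ 2 / 2 : ℝ≥0) : ℝ) : ℂ) =
      ∑ i, (((w i).re : ℂ) ^ 2 + ((w i).im : ℂ) ^ 2) / 2 := by
    rw [← Finset.sum_div]
    push_cast
    rw [← Complex.ofReal_pow, EuclideanSpace.norm_sq_eq]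
    push_cast
    congr 1
    refine Finset.sum_congr rfl fun i _ => ?_
    rw [← Complex.ofReal_pow, Complex.sq_norm, Complex.normSq_apply]
    push_cast
    ring
  rw [hn, ← Finset.sum_add_distrib, Finset.sum_mul, Finset.sum_div]
  simp only [Complex.ofReal_zero, mul_zero, zero_mul, zero_sub, ← Finset.sum_neg_distrib]
  refine Finset.sum_congr rfl fun i _ => ?_
  push_cast
  ring

theorem integrable_fun_sub {α : Type*} [MeasurableSpace α] {μ : Measure α} {f g : α → ℝ}
    (hf : Integrable f μ) (hg : Integrable g μ) : Integrable (fun x => f x - g x) μ :=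
  hf.sub hg

theorem measurable_dotProduct {n : ℕ} (w : Fin n → ℂ) :
    Measurable fun a : Fin n → ℂ => a ⬝ᵥ w := by
  unfold dotProduct; fun_prop

theorem integrable_comp_re_dotProduct {n : ℕ} (w : EuclideanSpace ℂ (Fin n)) {φ : ℝ → ℝ}
    (h : Integrable φ (gaussianReal 0 (‖w‖₊ ^ 2 / 2))) :
    Integrable (fun a : Fin n → ℂ => φ (a ⬝ᵥ w.ofLp).re) (complexGaussian n) := by
  rw [← map_re_dotProduct_complexGaussian] at h
  exact h.comp_measurable (Complex.measurable_re.comp (measurable_dotProduct _))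

theorem integral_comp_re_dotProduct {n : ℕ} (w : EuclideanSpace ℂ (Fin n)) {φ : ℝ → ℝ}
    (hφ : Continuous φ) :
    ∫ a, φ (a ⬝ᵥ w.ofLp).re ∂complexGaussian n = ∫ x, φ x ∂gaussianReal 0 (‖w‖₊ ^ 2 / 2) := by
  have hm : Measurable fun a : Fin n → ℂ => (a ⬝ᵥ w.ofLp).re :=
    Complex.measurable_re.comp (measurable_dotProduct _)
  rw [← map_re_dotProduct_complexGaussian, integral_map hm.aemeasurable hφ.aestronglyMeasurable]

theorem integrable_re_dotProduct_pow_four {n : ℕ} (w : EuclideanSpace ℂ (Fin n)) :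
    Integrable (fun a : Fin n → ℂ => (a ⬝ᵥ w.ofLp).re ^ 4) (complexGaussian n) :=
  integrable_comp_re_dotProduct w (integrable_pow_gaussianReal _ 4)

theorem integral_re_dotProduct_pow_four {n : ℕ} (w : EuclideanSpace ℂ (Fin n)) :
    ∫ a, (a ⬝ᵥ w.ofLp).re ^ 4 ∂complexGaussian n = 3 / 4 * ‖w‖ ^ 4 := by
  rw [integral_comp_re_dotProduct w (continuous_pow 4), integral_pow_four_gaussianReal]
  push_cast
  ring

/-- `|z|⁴` is a combination of fourth powers of real parts of multiples of `z`, so that its mean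
is determined by the laws of the real variables `Re (a ⬝ᵥ w)`. -/
theorem norm_dotProduct_pow_four_eq {n : ℕ} (w : EuclideanSpace ℂ (Fin n)) (a : Fin n → ℂ) :
    ‖a ⬝ᵥ w.ofLp‖ ^ 4 =
      2 / 3 * ((a ⬝ᵥ w.ofLp).re ^ 4 + (a ⬝ᵥ (Complex.I • w).ofLp).re ^ 4) +
        1 / 6 * ((a ⬝ᵥ ((1 + Complex.I) • w).ofLp).re ^ 4 +
          (a ⬝ᵥ ((1 - Complex.I) • w).ofLp).re ^ 4) := by
  rw [show ‖a ⬝ᵥ w.ofLp‖ ^ 4 = (‖a ⬝ᵥ w.ofLp‖ ^ 2) ^ 2 by ring, Complex.sq_norm,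
    Complex.normSq_apply]
  simp only [WithLp.ofLp_smul, dotProduct_smul, smul_eq_mul, Complex.mul_re, Complex.add_re,
    Complex.add_im, Complex.sub_re, Complex.sub_im, Complex.I_re, Complex.I_im, Complex.one_re,
    Complex.one_im]
  ring

theorem integrable_norm_dotProduct_pow_four {n : ℕ} (w : EuclideanSpace ℂ (Fin n)) :
    Integrable (fun a : Fin n → ℂ => ‖a ⬝ᵥ w.ofLp‖ ^ 4) (complexGaussian n) := by
  simp_rw [norm_dotProduct_pow_four_eq]
  exact (((integrable_re_dotProduct_pow_four _).add
    (integrable_re_dotProduct_pow_four _)).const_mul _).add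
    (((integrable_re_dotProduct_pow_four _).add
      (integrable_re_dotProduct_pow_four _)).const_mul _)

theorem integral_norm_dotProduct_pow_four {n : ℕ} (w : EuclideanSpace ℂ (Fin n)) :
    ∫ a, ‖a ⬝ᵥ w.ofLp‖ ^ 4 ∂complexGaussian n = 2 * ‖w‖ ^ 4 := by
  have h := fun w : EuclideanSpace ℂ (Fin n) => integrable_re_dotProduct_pow_four w
  simp_rw [norm_dotProduct_pow_four_eq]
  rw [integral_add (((h _).fun_add (h _)).const_mul _) (((h _).fun_add (h _)).const_mul _),
    integral_const_mul, integral_const_mul, integral_add (h _) (h _), integral_add (h _) (h _)]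
  simp only [integral_re_dotProduct_pow_four, norm_smul, mul_pow]
  have h4 : ∀ z : ℂ, ‖z‖ ^ 4 = Complex.normSq z ^ 2 := fun z => by
    rw [← Complex.sq_norm]; ring
  simp only [h4, Complex.normSq_apply]
  simp
  ring

/-- The square of `Re (conj P * Q)` as a combination of fourth powers of moduli of linear
combinations of `P` and `Q`. -/
theorem re_conj_mul_sq_eq (P Q : ℂ) :
    ((starRingEnd ℂ P) * Q).re ^ 2 =
      (3 * (‖P + Q‖ ^ 4 + ‖P - Q‖ ^ 4) - (‖P + Complex.I * Q‖ ^ 4 + ‖P - Complex.I * Q‖ ^ 4) -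
        4 * (‖P‖ ^ 4 + ‖Q‖ ^ 4)) / 32 := by
  have h4 : ∀ z : ℂ, ‖z‖ ^ 4 = Complex.normSq z ^ 2 := fun z => by
    rw [← Complex.sq_norm]; ring
  simp only [h4, Complex.normSq_apply, Complex.mul_re, Complex.mul_im, Complex.conj_re,
    Complex.conj_im, Complex.add_re, Complex.add_im, Complex.sub_re, Complex.sub_im,
    Complex.I_re, Complex.I_im]
  ring

theorem re_conj_dotProduct_sq_eq {n : ℕ} (p q : EuclideanSpace ℂ (Fin n)) (a : Fin n → ℂ) :
    ((starRingEnd ℂ (a ⬝ᵥ p.ofLp)) * (a ⬝ᵥ q.ofLp)).re ^ 2 =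
      (3 * (‖a ⬝ᵥ (p + q).ofLp‖ ^ 4 + ‖a ⬝ᵥ (p - q).ofLp‖ ^ 4) -
        (‖a ⬝ᵥ (p + Complex.I • q).ofLp‖ ^ 4 + ‖a ⬝ᵥ (p - Complex.I • q).ofLp‖ ^ 4) -
        4 * (‖a ⬝ᵥ p.ofLp‖ ^ 4 + ‖a ⬝ᵥ q.ofLp‖ ^ 4)) / 32 := by
  rw [re_conj_mul_sq_eq]
  simp only [WithLp.ofLp_smul, WithLp.ofLp_add, WithLp.ofLp_sub, dotProduct_smul, dotProduct_add,
    dotProduct_sub, smul_eq_mul]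

theorem integrable_re_conj_dotProduct_sq {n : ℕ} (p q : EuclideanSpace ℂ (Fin n)) :
    Integrable (fun a : Fin n → ℂ => ((starRingEnd ℂ (a ⬝ᵥ p.ofLp)) * (a ⬝ᵥ q.ofLp)).re ^ 2)
      (complexGaussian n) := by
  have h := fun w : EuclideanSpace ℂ (Fin n) => integrable_norm_dotProduct_pow_four w
  simp_rw [re_conj_dotProduct_sq_eq]
  exact (((((h _).add (h _)).const_mul 3).sub ((h _).add (h _))).sub
    (((h _).add (h _)).const_mul 4)).div_const 32

/-- The second moment of `Re (conj (a ⬝ᵥ p) * (a ⬝ᵥ q))`, obtained by polarization. -/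
theorem integral_re_conj_dotProduct_sq {n : ℕ} (p q : EuclideanSpace ℂ (Fin n)) :
    ∫ a, ((starRingEnd ℂ (a ⬝ᵥ p.ofLp)) * (a ⬝ᵥ q.ofLp)).re ^ 2 ∂complexGaussian n =
      (‖p‖ ^ 2 * ‖q‖ ^ 2 + 3 * (inner ℂ p q).re ^ 2 - (inner ℂ p q).im ^ 2) / 2 := by
  have h := fun w : EuclideanSpace ℂ (Fin n) => integrable_norm_dotProduct_pow_four w
  simp_rw [re_conj_dotProduct_sq_eq]
  rw [integral_div,
    integral_sub (integrable_fun_sub (((h _).fun_add (h _)).const_mul 3) ((h _).fun_add (h _)))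
      (((h _).fun_add (h _)).const_mul 4),
    integral_sub (((h _).fun_add (h _)).const_mul 3) ((h _).fun_add (h _)),
    integral_const_mul, integral_const_mul, integral_add (h _) (h _), integral_add (h _) (h _),
    integral_add (h _) (h _)]
  simp only [integral_norm_dotProduct_pow_four]
  have e : ∀ z : EuclideanSpace ℂ (Fin n), ‖z‖ ^ 4 = (‖z‖ ^ 2) ^ 2 := fun z => by ring
  have hI : ‖Complex.I • q‖ = ‖q‖ := by simp [norm_smul]
  have hre : (inner ℂ p (Complex.I • q)).re = -(inner ℂ p q).im := by
    simp
  simp only [e, norm_add_sq (𝕜 := ℂ), norm_sub_sq (𝕜 := ℂ), hI, RCLike.re_to_complex, hre]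
  ring

/-- The exponential moment of `|a ⬝ᵥ w|² / 4` for `‖w‖ ≤ 1`. -/
theorem integrable_exp_norm_dotProduct_sq {n : ℕ} {w : EuclideanSpace ℂ (Fin n)}
    (hw : ‖w‖ ≤ 1) :
    Integrable (fun a : Fin n → ℂ => Real.exp (‖a ⬝ᵥ w.ofLp‖ ^ 2 / 4)) (complexGaussian n) ∧
      ∫ a, Real.exp (‖a ⬝ᵥ w.ofLp‖ ^ 2 / 4) ∂complexGaussian n ≤ 2 := by
  have hreal : ∀ z : EuclideanSpace ℂ (Fin n), ‖z‖ ≤ 1 →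
      Integrable (fun a : Fin n → ℂ => Real.exp ((a ⬝ᵥ z.ofLp).re ^ 2 / 2))
        (complexGaussian n) ∧
      ∫ a, Real.exp ((a ⬝ᵥ z.ofLp).re ^ 2 / 2) ∂complexGaussian n ≤ 2 := by
    intro z hz
    have hv : ‖z‖₊ ^ 2 / 2 ≤ (1 / 2 : ℝ≥0) := by
      have : ‖z‖₊ ≤ 1 := hz
      gcongr
      exact pow_le_one₀ zero_le this
    obtain ⟨h1, h2⟩ := integrable_exp_sq_gaussianReal hv
    have hc : Continuous fun x : ℝ => Real.exp (x ^ 2 / 2) := by fun_prop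
    refine ⟨integrable_comp_re_dotProduct z h1, ?_⟩
    rw [integral_comp_re_dotProduct z hc]
    exact h2
  obtain ⟨i1, b1⟩ := hreal w hw
  obtain ⟨i2, b2⟩ := hreal (Complex.I • w) (by simpa [norm_smul] using hw)
  -- The exponential of the mean of two numbers is at most the mean of their exponentials.
  have hle : ∀ a : Fin n → ℂ, Real.exp (‖a ⬝ᵥ w.ofLp‖ ^ 2 / 4) ≤
      (Real.exp ((a ⬝ᵥ w.ofLp).re ^ 2 / 2) +
        Real.exp ((a ⬝ᵥ (Complex.I • w).ofLp).re ^ 2 / 2)) / 2 := by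
    intro a
    simp only [WithLp.ofLp_smul, dotProduct_smul, smul_eq_mul, Complex.I_mul_re]
    rw [Complex.sq_norm, Complex.normSq_apply]
    set x := (a ⬝ᵥ w.ofLp).re
    set y := (a ⬝ᵥ w.ofLp).im
    have e1 : Real.exp ((x * x + y * y) / 4) = Real.exp (x ^ 2 / 4) * Real.exp (y ^ 2 / 4) := by
      rw [← Real.exp_add]; ring_nf
    have e2 : Real.exp (x ^ 2 / 2) = Real.exp (x ^ 2 / 4) ^ 2 := by
      rw [← Real.exp_nat_mul]; ring_nf
    have e3 : Real.exp ((-y) ^ 2 / 2) = Real.exp (y ^ 2 / 4) ^ 2 := by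
      rw [← Real.exp_nat_mul]; ring_nf
    rw [e1, e2, e3]
    nlinarith [sq_nonneg (Real.exp (x ^ 2 / 4) - Real.exp (y ^ 2 / 4))]
  have i3 := (i1.add i2).div_const 2
  have i0 : Integrable (fun a : Fin n → ℂ => Real.exp (‖a ⬝ᵥ w.ofLp‖ ^ 2 / 4))
      (complexGaussian n) := by
    refine i3.mono' ?_ (Filter.Eventually.of_forall fun a => ?_)
    · exact (Real.measurable_exp.comp
        (((measurable_dotProduct _).norm.pow_const 2).div_const 4)).aestronglyMeasurable
    · rw [Real.norm_of_nonneg (Real.exp_pos _).le]; exact hle a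
  refine ⟨i0, (integral_mono i0 i3 hle).trans ?_⟩
  simp only [Pi.add_apply]
  rw [integral_div, integral_add i1 i2]
  linarith

theorem norm_pow_eight_le_exp (z : ℂ) : ‖z‖ ^ 8 ≤ 6144 * Real.exp (‖z‖ ^ 2 / 4) := by
  have h := Real.pow_div_factorial_le_exp (x := ‖z‖ ^ 2 / 4) (by positivity) 4
  norm_num [Nat.factorial] at h
  nlinarith

theorem integrable_norm_dotProduct_pow_eight {n : ℕ} {w : EuclideanSpace ℂ (Fin n)}
    (hw : ‖w‖ ≤ 1) :
    Integrable (fun a : Fin n → ℂ => ‖a ⬝ᵥ w.ofLp‖ ^ 8) (complexGaussian n) ∧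
      ∫ a, ‖a ⬝ᵥ w.ofLp‖ ^ 8 ∂complexGaussian n ≤ 12288 := by
  obtain ⟨i, b⟩ := integrable_exp_norm_dotProduct_sq hw
  have i1 := i.const_mul 6144
  have i0 : Integrable (fun a : Fin n → ℂ => ‖a ⬝ᵥ w.ofLp‖ ^ 8) (complexGaussian n) := by
    refine i1.mono' ((measurable_dotProduct _).norm.pow_const 8).aestronglyMeasurable
      (Filter.Eventually.of_forall fun a => ?_)
    rw [Real.norm_of_nonneg (by positivity)]
    exact norm_pow_eight_le_exp _
  refine ⟨i0, (integral_mono i0 i1 fun a => norm_pow_eight_le_exp _).trans ?_⟩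
  rw [integral_const_mul]
  linarith

theorem integrable_re_conj_dotProduct_pow_four {n : ℕ} {p q : EuclideanSpace ℂ (Fin n)}
    (hp : ‖p‖ ≤ 1) (hq : ‖q‖ ≤ 1) :
    Integrable (fun a : Fin n → ℂ => ((starRingEnd ℂ (a ⬝ᵥ p.ofLp)) * (a ⬝ᵥ q.ofLp)).re ^ 4)
      (complexGaussian n) ∧
    ∫ a, ((starRingEnd ℂ (a ⬝ᵥ p.ofLp)) * (a ⬝ᵥ q.ofLp)).re ^ 4 ∂complexGaussian n ≤ 12288 := by
  obtain ⟨i1, b1⟩ := integrable_norm_dotProduct_pow_eight hp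
  obtain ⟨i2, b2⟩ := integrable_norm_dotProduct_pow_eight hq
  have i3 := (i1.add i2).div_const 2
  have hle : ∀ a : Fin n → ℂ, ((starRingEnd ℂ (a ⬝ᵥ p.ofLp)) * (a ⬝ᵥ q.ofLp)).re ^ 4 ≤
      (‖a ⬝ᵥ p.ofLp‖ ^ 8 + ‖a ⬝ᵥ q.ofLp‖ ^ 8) / 2 := by
    intro a
    have h1 := Complex.abs_re_le_norm ((starRingEnd ℂ (a ⬝ᵥ p.ofLp)) * (a ⬝ᵥ q.ofLp))
    rw [norm_mul, RCLike.norm_conj] at h1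
    have h2 := pow_le_pow_left₀ (abs_nonneg _) h1 4
    rw [Even.pow_abs (by decide), mul_pow] at h2
    nlinarith [sq_nonneg (‖a ⬝ᵥ p.ofLp‖ ^ 4 - ‖a ⬝ᵥ q.ofLp‖ ^ 4)]
  have i0 : Integrable
      (fun a : Fin n → ℂ => ((starRingEnd ℂ (a ⬝ᵥ p.ofLp)) * (a ⬝ᵥ q.ofLp)).re ^ 4)
      (complexGaussian n) := by
    refine i3.mono' ?_ (Filter.Eventually.of_forall fun a => ?_)
    · refine Measurable.aestronglyMeasurable ?_
      unfold dotProduct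
      fun_prop
    · rw [Real.norm_of_nonneg (by positivity)]; exact hle a
  refine ⟨i0, (integral_mono i0 i3 hle).trans ?_⟩
  simp only [Pi.add_apply]
  rw [integral_div, integral_add i1 i2]
  linarith

/-! ### Exponential moments for the Chernoff bounds -/

theorem lintegral_upper_tail_le {n : ℕ} {w : EuclideanSpace ℂ (Fin n)} (hw : ‖w‖ ≤ 1) :
    ∫⁻ a, ENNReal.ofReal (Real.exp (‖a ⬝ᵥ w.ofLp‖ ^ 2 / 4 - 2)) ∂complexGaussian n ≤
      ENNReal.ofReal (Real.exp (-1)) := by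
  obtain ⟨i, b⟩ := integrable_exp_norm_dotProduct_sq hw
  have i' : Integrable (fun a : Fin n → ℂ => Real.exp (‖a ⬝ᵥ w.ofLp‖ ^ 2 / 4 - 2))
      (complexGaussian n) := by
    simp_rw [Real.exp_sub]
    exact i.div_const _
  rw [← ofReal_integral_eq_lintegral_ofReal i'
    (Filter.Eventually.of_forall fun a => (Real.exp_pos _).le)]
  refine ENNReal.ofReal_le_ofReal ?_
  simp_rw [Real.exp_sub, integral_div]
  rw [div_le_iff₀ (Real.exp_pos _), ← Real.exp_add]
  norm_num
  linarith [Real.add_one_le_exp 1]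

/-- A bound of the exponential in terms of even powers only, so that it can be averaged using the
second and fourth moments. -/
theorem exp_neg_le_quartic {z : ℝ} (hz : 0 ≤ z) :
    Real.exp (-z) ≤ 1 - z ^ 2 / 4 + z ^ 4 / 16 := by
  have h1 : Real.exp (-z) ≤ 1 / (1 + z) := by
    rw [Real.exp_neg, ← one_div]
    exact one_div_le_one_div_of_le (by linarith) (by linarith [Real.add_one_le_exp z])
  refine h1.trans ?_
  rw [div_le_iff₀ (by linarith)]
  have h2 : 0 ≤ 1 - z / 4 - z ^ 2 / 4 + z ^ 3 / 16 + z ^ 4 / 16 := by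
    nlinarith [sq_nonneg (z ^ 2 - 2), sq_nonneg (z - 1), mul_nonneg hz (sq_nonneg (z - 2)),
      sq_nonneg (z - 2), mul_nonneg hz (sq_nonneg (z - 1))]
  nlinarith [mul_nonneg hz h2]

/-- The estimate behind the lower bound: `Y = Re (conj (a ⬝ᵥ p) * (a ⬝ᵥ q))` is not concentrated
near zero, in the sense that the Laplace transform of `|Y|` at `1 / 256` is less than one. The
constants come from `E Y² ≥ 1 / 8` and `E Y⁴ ≤ 12288` through
`E exp (-θ |Y|) ≤ 1 - θ² E Y² / 4 + θ⁴ E Y⁴ / 16`. -/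
theorem lintegral_lower_tail_le {n : ℕ} {p q : EuclideanSpace ℂ (Fin n)} (hp : ‖p‖ ≤ 1)
    (hq : ‖q‖ ≤ 1) (hpq : 1 / 4 ≤ ‖p‖ ^ 2 * ‖q‖ ^ 2 - (inner ℂ p q).im ^ 2) :
    ∫⁻ a, ENNReal.ofReal (Real.exp (1 / 2 ^ 23 -
        |((starRingEnd ℂ (a ⬝ᵥ p.ofLp)) * (a ⬝ᵥ q.ofLp)).re| / 256)) ∂complexGaussian n ≤
      ENNReal.ofReal (Real.exp (-(1 / 2 ^ 23))) := by
  have i2 := integrable_re_conj_dotProduct_sq p q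
  have e2 := integral_re_conj_dotProduct_sq p q
  obtain ⟨i4, b4⟩ := integrable_re_conj_dotProduct_pow_four hp hq
  set Y : (Fin n → ℂ) → ℝ := fun a => ((starRingEnd ℂ (a ⬝ᵥ p.ofLp)) * (a ⬝ᵥ q.ofLp)).re
  change Integrable (fun a => Y a ^ 2) _ at i2
  change ∫ a, Y a ^ 2 ∂_ = _ at e2
  change Integrable (fun a => Y a ^ 4) _ at i4
  change ∫ a, Y a ^ 4 ∂_ ≤ _ at b4
  change ∫⁻ a, ENNReal.ofReal (Real.exp (1 / 2 ^ 23 - |Y a| / 256)) ∂_ ≤ _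
  have hYm : Measurable Y := by
    unfold Y dotProduct
    fun_prop
  have i5 : Integrable (fun a => 1 - Y a ^ 2 / 2 ^ 18 + Y a ^ 4 / 2 ^ 36) (complexGaussian n) :=
    ((integrable_const _).sub (i2.div_const _)).add (i4.div_const _)
  have hle : ∀ a, Real.exp (-(|Y a| / 256)) ≤ 1 - Y a ^ 2 / 2 ^ 18 + Y a ^ 4 / 2 ^ 36 := by
    intro a
    refine (exp_neg_le_quartic (by positivity)).trans (le_of_eq ?_)
    rw [div_pow, div_pow, sq_abs, Even.pow_abs (by decide)]
    ring
  have i0 : Integrable (fun a => Real.exp (-(|Y a| / 256))) (complexGaussian n) :=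
    i5.mono' (by fun_prop) (Filter.Eventually.of_forall fun a => by
      rw [Real.norm_of_nonneg (Real.exp_pos _).le]; exact hle a)
  have h1 : ∫ a, Real.exp (-(|Y a| / 256)) ∂complexGaussian n ≤ 1 - 1 / 2 ^ 22 := by
    refine (integral_mono i0 i5 hle).trans ?_
    rw [integral_add (integrable_fun_sub (integrable_const _) (i2.div_const _)) (i4.div_const _),
      integral_sub (integrable_const _) (i2.div_const _), integral_div, integral_div, e2]
    simp only [integral_const, probReal_univ, smul_eq_mul]
    nlinarith [sq_nonneg (inner ℂ p q).re]
  have i6 : Integrable (fun a => Real.exp (1 / 2 ^ 23 - |Y a| / 256)) (complexGaussian n) := by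
    simp_rw [sub_eq_add_neg, Real.exp_add]
    exact i0.const_mul _
  rw [← ofReal_integral_eq_lintegral_ofReal i6
    (Filter.Eventually.of_forall fun a => (Real.exp_pos _).le)]
  refine ENNReal.ofReal_le_ofReal ?_
  simp_rw [sub_eq_add_neg, Real.exp_add, integral_const_mul]
  calc Real.exp (1 / 2 ^ 23) * ∫ a, Real.exp (-(|Y a| / 256)) ∂complexGaussian n
      ≤ Real.exp (1 / 2 ^ 23) * Real.exp (-(1 / 2 ^ 22)) := by
        gcongr
        linarith [Real.add_one_le_exp (-(1 / 2 ^ 22 : ℝ))]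
    _ = Real.exp (-(1 / 2 ^ 23)) := by rw [← Real.exp_add]; norm_num

/-- Chernoff's bound for a sum of a function of independent complex Gaussian vectors. -/
theorem measure_sum_nonneg_le {m n : ℕ} {Ω : Type*} [MeasurableSpace Ω] {P : Measure Ω}
    {a : Fin m → Ω → (Fin n → ℂ)} (ha : ∀ j, HasLaw (a j) (complexGaussian n) P)
    (hind : iIndepFun a P) {φ : (Fin n → ℂ) → ℝ} (hφ : Measurable φ) {η : ℝ}
    (h : ∫⁻ x, ENNReal.ofReal (Real.exp (φ x)) ∂complexGaussian n ≤
      ENNReal.ofReal (Real.exp (-η))) :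
    P {ω | 0 ≤ ∑ j, φ (a j ω)} ≤ ENNReal.ofReal (Real.exp (-(η * m))) := by
  have hlaw := hind.hasLaw_pi ha
  have hS : Measurable fun x : Fin m → Fin n → ℂ => ∑ j, φ (x j) := by fun_prop
  have hset : MeasurableSet {x : Fin m → Fin n → ℂ | 0 ≤ ∑ j, φ (x j)} :=
    measurableSet_le measurable_const hS
  have e1 : P {ω | 0 ≤ ∑ j, φ (a j ω)} =
      Measure.pi (fun _ : Fin m => complexGaussian n) {x | 0 ≤ ∑ j, φ (x j)} :=
    hlaw.measure_eq hset
  have hf : Measurable fun x : Fin n → ℂ => ENNReal.ofReal (Real.exp (φ x)) := by fun_prop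
  have hind' : iIndepFun (fun (j : Fin m) (x : Fin m → Fin n → ℂ) =>
      ENNReal.ofReal (Real.exp (φ (x j)))) (Measure.pi fun _ : Fin m => complexGaussian n) :=
    iIndepFun_pi (μ := fun _ : Fin m => complexGaussian n)
      (X := fun _ (x : Fin n → ℂ) => ENNReal.ofReal (Real.exp (φ x))) fun _ => hf.aemeasurable
  have e2 := lintegral_prod_eq_prod_lintegral_of_indepFun Finset.univ _ hind'
    (fun j => hf.comp (measurable_pi_apply j))
  have e3 : ∀ j : Fin m, ∫⁻ x : Fin m → Fin n → ℂ, ENNReal.ofReal (Real.exp (φ (x j)))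
      ∂Measure.pi (fun _ : Fin m => complexGaussian n) =
      ∫⁻ x, ENNReal.ofReal (Real.exp (φ x)) ∂complexGaussian n := fun j =>
    (measurePreserving_eval (fun _ : Fin m => complexGaussian n) j).lintegral_comp hf
  have hsub : {x : Fin m → Fin n → ℂ | 0 ≤ ∑ j, φ (x j)} ⊆
      {x | 1 ≤ ∏ j, ENNReal.ofReal (Real.exp (φ (x j)))} := by
    intro x hx
    rw [Set.mem_ofPred_eq] at hx ⊢
    rw [← ENNReal.ofReal_prod_of_nonneg fun j _ => (Real.exp_pos _).le, ← Real.exp_sum,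
      ENNReal.one_le_ofReal]
    exact Real.one_le_exp hx
  have hmarkov := mul_meas_ge_le_lintegral
    (μ := Measure.pi fun _ : Fin m => complexGaussian n)
    (f := fun x : Fin m → Fin n → ℂ => ∏ j, ENNReal.ofReal (Real.exp (φ (x j))))
    (by fun_prop) 1
  rw [one_mul, e2] at hmarkov
  rw [e1]
  refine (measure_mono hsub).trans (hmarkov.trans ?_)
  simp_rw [e3]
  rw [Finset.prod_const, Finset.card_univ, Fintype.card_fin]
  refine (pow_le_pow_left₀ zero_le h m).trans ?_
  rw [← ENNReal.ofReal_pow (Real.exp_pos _).le, ← Real.exp_nat_mul]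
  refine ENNReal.ofReal_le_ofReal (le_of_eq ?_)
  ring_nf

/-! ### Nets of sparse vectors -/

open Module in
open scoped Function in
/-- The volume bound for the size of a separated subset of the unit ball: the balls of radius
`ε / 2` around its points are disjoint and lie in the ball of radius `1 + ε / 2`. -/
theorem card_le_of_separated_unit_ball {E : Type*} [NormedAddCommGroup E] [NormedSpace ℝ E]
    [FiniteDimensional ℝ E] {ε : ℝ} (hε : 0 < ε) (s : Finset E) (hs : ∀ c ∈ s, ‖c‖ ≤ 1)
    (h : ∀ c ∈ s, ∀ d ∈ s, c ≠ d → ε ≤ ‖c - d‖) :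
    (s.card : ℝ) ≤ (1 + 2 / ε) ^ finrank ℝ E := by
  borelize E
  let μ : Measure E := Measure.addHaar
  have hδ : 0 < ε / 2 := by positivity
  have hρ : 0 < 1 + ε / 2 := by positivity
  have D : Set.Pairwise (s : Set E) (Disjoint on fun c => Metric.ball c (ε / 2)) := by
    rintro c hc d hd hcd
    apply Metric.ball_disjoint_ball
    rw [dist_eq_norm]
    linarith [h c hc d hd hcd]
  have hsub : (⋃ c ∈ s, Metric.ball c (ε / 2)) ⊆ Metric.ball (0 : E) (1 + ε / 2) := by
    refine Set.iUnion₂_subset fun x hx => Metric.ball_subset_ball' ?_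
    rw [dist_zero_right]
    linarith [hs x hx]
  have I : (s.card : ENNReal) * ENNReal.ofReal ((ε / 2) ^ finrank ℝ E) * μ (Metric.ball 0 1) ≤
      ENNReal.ofReal ((1 + ε / 2) ^ finrank ℝ E) * μ (Metric.ball 0 1) :=
    calc
      _ = μ (⋃ c ∈ s, Metric.ball c (ε / 2)) := by
        rw [measure_biUnion_finset D fun c _ => measurableSet_ball]
        simp only [μ.addHaar_ball_of_pos _ hδ, Finset.sum_const, nsmul_eq_mul, mul_assoc]
      _ ≤ μ (Metric.ball (0 : E) (1 + ε / 2)) := measure_mono hsub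
      _ = _ := by simp only [μ.addHaar_ball_of_pos _ hρ]
  have J := (ENNReal.mul_le_mul_iff_left (Metric.measure_ball_pos μ _ zero_lt_one).ne'
    measure_ball_lt_top.ne).1 I
  have K := ENNReal.toReal_le_of_le_ofReal (pow_nonneg hρ.le _) J
  rw [ENNReal.toReal_mul, ENNReal.toReal_natCast, ENNReal.toReal_ofReal (by positivity),
    ← le_div_iff₀ (by positivity), ← div_pow] at K
  rwa [show (1 + ε / 2) / (ε / 2) = 1 + 2 / ε by field_simp; ring] at K

open Module in
/-- The unit ball of a finite-dimensional space contains an `ε`-net of controlled size. -/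
theorem exists_net_unit_ball (E : Type*) [NormedAddCommGroup E] [NormedSpace ℝ E]
    [FiniteDimensional ℝ E] {ε : ℝ} (hε : 0 < ε) :
    ∃ N : Finset E, (N.card : ℝ) ≤ (1 + 2 / ε) ^ finrank ℝ E ∧ (∀ y ∈ N, ‖y‖ ≤ 1) ∧
      ∀ x : E, ‖x‖ ≤ 1 → ∃ y ∈ N, ‖x - y‖ ≤ ε := by
  classical
  -- A separated set of the largest possible size is a net.
  let S : Set ℕ := {c | ∃ s : Finset E, (∀ x ∈ s, ‖x‖ ≤ 1) ∧
    (∀ x ∈ s, ∀ y ∈ s, x ≠ y → ε ≤ ‖x - y‖) ∧ s.card = c}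
  have hne : S.Nonempty := ⟨0, ∅, by simp⟩
  have hbdd : BddAbove S := by
    refine ⟨⌊(1 + 2 / ε) ^ finrank ℝ E⌋₊, ?_⟩
    rintro c ⟨s, h1, h2, rfl⟩
    exact Nat.le_floor (card_le_of_separated_unit_ball hε s h1 h2)
  obtain ⟨s, h1, h2, h3⟩ := Nat.sSup_mem hne hbdd
  refine ⟨s, card_le_of_separated_unit_ball hε s h1 h2, h1, fun x hx => ?_⟩
  by_contra! hfar
  have hxs : x ∉ s := fun hxs => by
    have := hfar x hxs
    simp only [sub_self, norm_zero] at this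
    exact absurd this (not_lt.2 hε.le)
  have hmem : (insert x s).card ∈ S := by
    refine ⟨insert x s, ?_, ?_, rfl⟩
    · intro y hy
      rcases Finset.mem_insert.1 hy with rfl | hy
      exacts [hx, h1 y hy]
    · intro y hy z hz hyz
      rcases Finset.mem_insert.1 hy with rfl | hy'
      · rcases Finset.mem_insert.1 hz with rfl | hz
        · exact absurd rfl hyz
        · exact (hfar z hz).le
      · rcases Finset.mem_insert.1 hz with rfl | hz
        · rw [norm_sub_rev]; exact (hfar y hy').le
        · exact h2 y hy' z hz hyz
  have := le_csSup hbdd hmem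
  rw [← h3, Finset.card_insert_of_notMem hxs] at this
  omega

/-- Extension by zero from the coordinates in `T`. -/
def extendByZero {n : ℕ} (T : Finset (Fin n)) (y : EuclideanSpace ℂ T) :
    EuclideanSpace ℂ (Fin n) :=
  WithLp.toLp 2 fun i => if h : i ∈ T then y ⟨i, h⟩ else 0

theorem extendByZero_sub {n : ℕ} (T : Finset (Fin n)) (y z : EuclideanSpace ℂ T) :
    extendByZero T (y - z) = extendByZero T y - extendByZero T z := by
  ext i
  by_cases h : i ∈ T <;> simp [extendByZero, h]

theorem norm_extendByZero {n : ℕ} (T : Finset (Fin n)) (y : EuclideanSpace ℂ T) :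
    ‖extendByZero T y‖ = ‖y‖ := by
  rw [← sq_eq_sq₀ (norm_nonneg _) (norm_nonneg _), EuclideanSpace.norm_sq_eq,
    EuclideanSpace.norm_sq_eq]
  have h0 : ∀ i ∉ T, ‖(extendByZero T y).ofLp i‖ ^ 2 = 0 := fun i hi => by
    simp [extendByZero, hi]
  rw [← Finset.sum_subset (Finset.subset_univ T) fun i _ hi => h0 i hi, ← Finset.sum_coe_sort T]
  refine Finset.sum_congr rfl fun i _ => ?_
  simp [extendByZero]

/-- A net of the vectors of the unit ball that are supported in `T`. -/
theorem exists_net_supported {n : ℕ} (T : Finset (Fin n)) {ε : ℝ} (hε : 0 < ε) :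
    ∃ N : Finset (EuclideanSpace ℂ (Fin n)), (N.card : ℝ) ≤ (1 + 2 / ε) ^ (2 * T.card) ∧
      (∀ y ∈ N, ‖y‖ ≤ 1 ∧ ∀ i ∉ T, y i = 0) ∧
      ∀ x : EuclideanSpace ℂ (Fin n), (∀ i ∉ T, x i = 0) → ‖x‖ ≤ 1 → ∃ y ∈ N, ‖x - y‖ ≤ ε := by
  classical
  obtain ⟨N, h1, h2, h3⟩ := exists_net_unit_ball (EuclideanSpace ℂ T) hε
  have hrank : Module.finrank ℝ (EuclideanSpace ℂ T) = 2 * T.card := by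
    rw [← Module.finrank_mul_finrank ℝ ℂ (EuclideanSpace ℂ T), Complex.finrank_real_complex,
      finrank_euclideanSpace, Fintype.card_coe]
  rw [hrank] at h1
  refine ⟨N.image (extendByZero T), ?_, ?_, ?_⟩
  · exact (Nat.cast_le.2 Finset.card_image_le).trans h1
  · intro y hy
    obtain ⟨z, hz, rfl⟩ := Finset.mem_image.1 hy
    refine ⟨by rw [norm_extendByZero]; exact h2 z hz, fun i hi => by simp [extendByZero, hi]⟩
  · intro x hx hx1
    have hxe : extendByZero T (WithLp.toLp 2 fun i : T => x i) = x := by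
      ext i
      by_cases h : i ∈ T
      · simp [extendByZero, h]
      · simp [extendByZero, h, hx i h]
    obtain ⟨y, hy, hxy⟩ := h3 (WithLp.toLp 2 fun i : T => x i) (by
      rw [← norm_extendByZero, hxe]; exact hx1)
    refine ⟨extendByZero T y, Finset.mem_image_of_mem _ hy, ?_⟩
    rw [← norm_extendByZero, extendByZero_sub, hxe] at hxy
    exact hxy

/-- The number of supports of size at most `s`. The bound `(e n / k) ^ s` with `k ≤ s` in place of
`s` in the denominator needs no upper bound on `s`. -/
theorem card_supports_le {n k s : ℕ} (hk : 1 ≤ k) (hkn : k ≤ n) (hks : k ≤ s) :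
    (((Finset.univ : Finset (Finset (Fin n))).filter fun T => T.card ≤ s).card : ℝ) ≤
      Real.exp (s * Real.log (Real.exp 1 * n / k)) := by
  have hk0 : (0 : ℝ) < k := by exact_mod_cast hk
  have hn0 : (0 : ℝ) < n := by exact_mod_cast hk.trans hkn
  -- Each support `T` is weighted by `t ^ |T|`, with `t = k / n ≤ 1`.
  set t : ℝ := k / n with ht
  have ht0 : 0 < t := by positivity
  have ht1 : t ≤ 1 := by
    rw [ht, div_le_one hn0]; exact_mod_cast hkn
  have h1 : (((Finset.univ : Finset (Finset (Fin n))).filter fun T => T.card ≤ s).card : ℝ) * t ^ s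
      ≤ (t + 1) ^ n := by
    have := Finset.sum_pow_mul_eq_add_pow t 1 (Finset.univ : Finset (Fin n))
    rw [Finset.card_univ, Fintype.card_fin] at this
    rw [← this, ← nsmul_eq_mul, ← Finset.sum_const]
    refine (Finset.sum_le_sum fun T hT => ?_).trans
      (Finset.sum_le_sum_of_subset_of_nonneg (f := fun T : Finset (Fin n) =>
        t ^ T.card * 1 ^ (n - T.card)) (fun T _ => by simp) fun T _ _ => by positivity)
    rw [one_pow, mul_one]
    exact pow_le_pow_of_le_one ht0.le ht1 (Finset.mem_filter.1 hT).2
  have h2 : (t + 1) ^ n ≤ Real.exp s := by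
    calc (t + 1) ^ n ≤ Real.exp t ^ n := by gcongr; exact Real.add_one_le_exp t
      _ = Real.exp k := by
        rw [← Real.exp_nat_mul, ht]
        congr 1
        field_simp
      _ ≤ Real.exp s := by gcongr
  have h3 : Real.exp (s * Real.log (Real.exp 1 * n / k)) * t ^ s = Real.exp s := by
    rw [Real.exp_nat_mul, Real.exp_log (by positivity), ← mul_pow, ← mul_one (s : ℝ),
      Real.exp_nat_mul, ht]
    congr 1
    field_simp
  refine le_of_mul_le_mul_right ?_ (pow_pos ht0 s)
  rw [h3]
  exact h1.trans h2

/-! ### Deterministic recovery -/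

/-- The vector with the coordinates of `x` on `T` and zeros elsewhere. -/
def restrictTo {n : ℕ} (T : Finset (Fin n)) (x : EuclideanSpace ℂ (Fin n)) :
    EuclideanSpace ℂ (Fin n) :=
  WithLp.toLp 2 fun i => if i ∈ T then x i else 0

theorem restrictTo_apply {n : ℕ} (T : Finset (Fin n)) (x : EuclideanSpace ℂ (Fin n)) (i : Fin n) :
    restrictTo T x i = if i ∈ T then x i else 0 := rfl

theorem restrictTo_apply_of_notMem {n : ℕ} (T : Finset (Fin n)) (x : EuclideanSpace ℂ (Fin n)) :
    ∀ i ∉ T, restrictTo T x i = 0 := fun i hi => by simp [restrictTo_apply, hi]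

theorem restrictTo_union {n : ℕ} {S T : Finset (Fin n)} (h : Disjoint S T)
    (x : EuclideanSpace ℂ (Fin n)) :
    restrictTo (S ∪ T) x = restrictTo S x + restrictTo T x := by
  ext i
  rw [PiLp.add_apply]
  simp only [restrictTo_apply, Finset.mem_union]
  by_cases h1 : i ∈ S
  · simp [h1, Finset.disjoint_left.1 h h1]
  · simp [h1]

theorem restrictTo_univ {n : ℕ} (x : EuclideanSpace ℂ (Fin n)) :
    restrictTo Finset.univ x = x := by
  ext i; simp [restrictTo_apply]

theorem norm_restrictTo_sq {n : ℕ} (T : Finset (Fin n)) (x : EuclideanSpace ℂ (Fin n)) :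
    ‖restrictTo T x‖ ^ 2 = ∑ i ∈ T, ‖x i‖ ^ 2 := by
  rw [EuclideanSpace.norm_sq_eq]
  rw [← Finset.sum_subset (Finset.subset_univ T) fun i _ hi => by
    rw [restrictTo_apply_of_notMem T x i hi]; simp]
  exact Finset.sum_congr rfl fun i hi => by simp [restrictTo_apply, hi]

theorem sum_norm_le_sqrt_card_mul_norm {n : ℕ} (T : Finset (Fin n))
    (x : EuclideanSpace ℂ (Fin n)) : ∑ i ∈ T, ‖x i‖ ≤ √T.card * ‖x‖ := by
  have h := Real.sum_mul_le_sqrt_mul_sqrt T (fun _ => (1 : ℝ)) (fun i => ‖x i‖)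
  simp only [one_mul, one_pow, Finset.sum_const, nsmul_eq_mul, mul_one] at h
  refine h.trans ?_
  gcongr
  rw [EuclideanSpace.norm_eq]
  gcongr
  exact Finset.subset_univ T

theorem exists_subset_card_largest {ι : Type*} [DecidableEq ι] (f : ι → ℝ) (U : Finset ι)
    (s : ℕ) (hs : s ≤ U.card) :
    ∃ T ⊆ U, T.card = s ∧ ∀ i ∈ T, ∀ j ∈ U \ T, f j ≤ f i := by
  induction s with
  | zero => exact ⟨∅, by simp⟩
  | succ s ih =>
    obtain ⟨T, hTU, hT, hmax⟩ := ih (by omega)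
    have hne : (U \ T).Nonempty := by
      rw [← Finset.card_pos, Finset.card_sdiff_of_subset hTU]; omega
    obtain ⟨i₀, hi₀, hi₀max⟩ := Finset.exists_max_image (U \ T) f hne
    have hi₀' := Finset.mem_sdiff.1 hi₀
    refine ⟨insert i₀ T, Finset.insert_subset hi₀'.1 hTU, ?_, ?_⟩
    · rw [Finset.card_insert_of_notMem hi₀'.2, hT]
    · intro i hi j hj
      have hj' : j ∈ U \ T := by
        simp only [Finset.mem_sdiff, Finset.mem_insert, not_or] at hj ⊢
        exact ⟨hj.1, hj.2.2⟩
      rcases Finset.mem_insert.1 hi with rfl | hi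
      · exact hi₀max j hj'
      · exact hmax i hi j hj'

/-- Removing a suitable block of `s` coordinates (the largest ones) from `U` leaves a vector whose
image under `L` is controlled by the `ℓ¹` norm. The remaining coordinates are split into blocks of
size `s` in decreasing order; the `ℓ²` norm of each block is at most the `ℓ¹` norm of the preceding
one divided by `√s`. -/
theorem exists_block_norm_le {n : ℕ} {F : Type*} [NormedAddCommGroup F] [NormedSpace ℂ F]
    (L : EuclideanSpace ℂ (Fin n) →ₗ[ℂ] F) {s : ℕ} (hs : 1 ≤ s) {κ : ℝ} (hκ : 0 ≤ κ)
    (hL : ∀ (T : Finset (Fin n)) (x : EuclideanSpace ℂ (Fin n)), T.card ≤ s →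
      (∀ i ∉ T, x i = 0) → ‖L x‖ ≤ κ * ‖x‖)
    (x : EuclideanSpace ℂ (Fin n)) (U : Finset (Fin n)) :
    ∃ T ⊆ U, T.card ≤ s ∧ ‖L (restrictTo (U \ T) x)‖ ≤ κ * ((∑ i ∈ U, ‖x i‖) / √s) := by
  have hs0 : (0 : ℝ) < s := by exact_mod_cast hs
  have hsq : 0 < √(s : ℝ) := Real.sqrt_pos.2 hs0
  induction hU : U.card using Nat.strong_induction_on generalizing U with
  | _ N ih =>
  rcases Nat.lt_or_ge s U.card with hlt | hle
  · obtain ⟨T, hTU, hT, hmax⟩ := exists_subset_card_largest (fun i => ‖x i‖) U s hlt.le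
    have hcard : (U \ T).card < N := by
      rw [Finset.card_sdiff_of_subset hTU]; omega
    obtain ⟨T', hT'U, hT', hb⟩ := ih _ hcard (U \ T) rfl
    refine ⟨T, hTU, hT.le, ?_⟩
    have hsplit : restrictTo (U \ T) x = restrictTo T' x + restrictTo ((U \ T) \ T') x := by
      rw [← restrictTo_union Finset.disjoint_sdiff, Finset.union_sdiff_of_subset hT'U]
    -- Every entry outside `T` is at most the mean of the entries in `T`.
    have hentry : ∀ j ∈ U \ T, ‖x j‖ ≤ (∑ i ∈ T, ‖x i‖) / s := by
      intro j hj
      rw [le_div_iff₀ hs0, mul_comm, ← hT, ← nsmul_eq_mul]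
      exact Finset.card_nsmul_le_sum T _ _ fun i hi => hmax i hi j hj
    have hnn : 0 ≤ ∑ i ∈ T, ‖x i‖ := Finset.sum_nonneg fun i _ => norm_nonneg _
    have hT'norm : ‖restrictTo T' x‖ ≤ (∑ i ∈ T, ‖x i‖) / √s := by
      rw [← sq_le_sq₀ (norm_nonneg _) (by positivity), norm_restrictTo_sq, div_pow,
        Real.sq_sqrt hs0.le]
      calc ∑ i ∈ T', ‖x i‖ ^ 2 ≤ T'.card • ((∑ i ∈ T, ‖x i‖) / s) ^ 2 := by
            refine Finset.sum_le_card_nsmul _ _ _ fun i hi => ?_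
            have := hentry i (hT'U hi)
            gcongr
        _ ≤ s * ((∑ i ∈ T, ‖x i‖) / s) ^ 2 := by
            rw [nsmul_eq_mul]
            gcongr
        _ = (∑ i ∈ T, ‖x i‖) ^ 2 / s := by
            field_simp
    have hsum : ∑ i ∈ U, ‖x i‖ = ∑ i ∈ T, ‖x i‖ + ∑ i ∈ U \ T, ‖x i‖ := by
      rw [add_comm, Finset.sum_sdiff hTU]
    rw [hsplit, map_add, hsum, add_div, mul_add]
    refine (norm_add_le _ _).trans (add_le_add ?_ hb)
    refine (hL T' _ hT' (restrictTo_apply_of_notMem T' x)).trans ?_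
    gcongr
  · refine ⟨U, subset_rfl, hle, ?_⟩
    have h0 : restrictTo (U \ U) x = 0 := by
      ext i; simp [restrictTo_apply]
    rw [h0, map_zero, norm_zero]
    have : 0 ≤ ∑ i ∈ U, ‖x i‖ := Finset.sum_nonneg fun i _ => norm_nonneg _
    positivity

theorem sum_abs_re_conj_mul_le {m : ℕ} (u v : EuclideanSpace ℂ (Fin m)) :
    ∑ j, |((starRingEnd ℂ (u j)) * v j).re| ≤ ‖u‖ * ‖v‖ := by
  have h := Real.sum_mul_le_sqrt_mul_sqrt Finset.univ (fun j => ‖u j‖) (fun j => ‖v j‖)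
  rw [← EuclideanSpace.norm_eq, ← EuclideanSpace.norm_eq] at h
  refine (Finset.sum_le_sum fun j _ => ?_).trans h
  refine (Complex.abs_re_le_norm _).trans ?_
  rw [norm_mul, RCLike.norm_conj]

/-- The two properties of the measurement map `L` that force recovery: it is bounded by `κ` on
vectors with at most `s` nonzero entries, and the intensities `|L x|²` separate such vectors:
for `p = x - y` and `q = x + y`, the sum below is `∑ j, ||(L x) j|² - |(L y) j|²|`. -/
structure SeparatesSparse {m n : ℕ} (L : EuclideanSpace ℂ (Fin n) →ₗ[ℂ] EuclideanSpace ℂ (Fin m))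
    (s : ℕ) (κ c : ℝ) : Prop where
  norm_le : ∀ (T : Finset (Fin n)) (x : EuclideanSpace ℂ (Fin n)), T.card ≤ s →
    (∀ i ∉ T, x i = 0) → ‖L x‖ ≤ κ * ‖x‖
  le_sum : ∀ (T : Finset (Fin n)) (p q : EuclideanSpace ℂ (Fin n)), T.card ≤ s →
    (∀ i ∉ T, p i = 0) → (∀ i ∉ T, q i = 0) → (inner ℂ p q).im = 0 →
    c * (‖p‖ * ‖q‖) ≤ ∑ j, |((starRingEnd ℂ (L p j)) * L q j).re|

/-- Recovery for a competitor `x` whose phase is aligned with the sparse vector `y`. -/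
theorem SeparatesSparse.eq_of_aligned {m n k s : ℕ}
    {L : EuclideanSpace ℂ (Fin n) →ₗ[ℂ] EuclideanSpace ℂ (Fin m)} {κ c δ : ℝ}
    (hL : SeparatesSparse L (k + s) κ c) (hs : 1 ≤ s) (hκ : 0 ≤ κ) (hδ : √k / √s ≤ δ)
    (hc : κ ^ 2 * δ * (2 + δ) < c) {x y : EuclideanSpace ℂ (Fin n)}
    (hy : IsSparse k y.ofLp) (hxy : ∀ j, ‖L x j‖ = ‖L y j‖)
    (hl1 : l1Norm x.ofLp ≤ l1Norm y.ofLp) (him : (inner ℂ y x).im = 0)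
    (hre : 0 ≤ (inner ℂ y x).re) : x = y := by
  classical
  have hδ0 : 0 ≤ δ := le_trans (by positivity) hδ
  set S : Finset (Fin n) := Finset.univ.filter fun i => y i ≠ 0 with hS
  have hSk : S.card ≤ k := hy
  have hyS : ∀ i ∉ S, y i = 0 := fun i hi => by simpa [hS] using hi
  obtain ⟨T, hTU, hT, htail⟩ := exists_block_norm_le L hs hκ
    (fun T x hT => hL.norm_le T x (by omega)) x Sᶜ
  have hST : Disjoint S T := disjoint_compl_right.mono_right hTU
  have hcard : (S ∪ T).card ≤ k + s := (Finset.card_union_le _ _).trans (by omega)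
  set x' := restrictTo (S ∪ T) x with hx'
  set t := restrictTo (Sᶜ \ T) x with ht
  have hsplit : x = x' + t := by
    have hd : Disjoint (S ∪ T) (Sᶜ \ T) := by
      rw [Finset.disjoint_left]
      intro i hi
      simp only [Finset.mem_union, Finset.mem_sdiff, Finset.mem_compl] at hi ⊢
      tauto
    rw [hx', ht, ← restrictTo_union hd]
    conv_lhs => rw [← restrictTo_univ x]
    congr 1
    ext i
    simp only [Finset.mem_univ, Finset.mem_union, Finset.mem_sdiff, Finset.mem_compl, true_iff]
    tauto
  have hx'S : ∀ i ∈ S, x' i = x i := fun i hi => by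
    simp [hx', restrictTo_apply, hi]
  set p := x' - y with hp
  set q := x' + y with hq
  have hx'0 : ∀ i ∉ S ∪ T, x' i = 0 := restrictTo_apply_of_notMem _ x
  have hy0 : ∀ i ∉ S ∪ T, y i = 0 := fun i hi => hyS i fun h => hi (Finset.mem_union_left _ h)
  have hp0 : ∀ i ∉ S ∪ T, p i = 0 := fun i hi => by simp [hp, hx'0 i hi, hy0 i hi]
  have hq0 : ∀ i ∉ S ∪ T, q i = 0 := fun i hi => by simp [hq, hx'0 i hi, hy0 i hi]
  have hinner : inner ℂ y x' = inner ℂ y x := by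
    rw [PiLp.inner_apply, PiLp.inner_apply]
    refine Finset.sum_congr rfl fun i _ => ?_
    by_cases hi : i ∈ S
    · rw [hx'S i hi]
    · rw [hyS i hi, inner_zero_left, inner_zero_left]
  have hpq : (inner ℂ p q).im = 0 := by
    have h1 : (inner ℂ x' y).im = -(inner ℂ y x').im := by
      rw [← inner_conj_symm, Complex.conj_im]
    have h2 : (inner ℂ x' x').im = 0 := inner_self_im (𝕜 := ℂ) x'
    have h3 : (inner ℂ y y).im = 0 := inner_self_im (𝕜 := ℂ) y
    rw [hp, hq, inner_sub_left, inner_add_right, inner_add_right, Complex.sub_im, Complex.add_im,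
      Complex.add_im, h1, h2, h3, hinner, him]
    simp
  have hr : (inner ℂ x' y).re = (inner ℂ y x).re := by
    rw [← hinner, ← inner_conj_symm, Complex.conj_re]
  have hp2 : ‖p‖ ^ 2 = ‖x'‖ ^ 2 - 2 * (inner ℂ y x).re + ‖y‖ ^ 2 := by
    rw [hp, norm_sub_sq (𝕜 := ℂ), RCLike.re_to_complex, hr]
  have hq2 : ‖q‖ ^ 2 = ‖x'‖ ^ 2 + 2 * (inner ℂ y x).re + ‖y‖ ^ 2 := by
    rw [hq, norm_add_sq (𝕜 := ℂ), RCLike.re_to_complex, hr]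
  have hple : ‖p‖ ≤ ‖q‖ := by
    rw [← sq_le_sq₀ (norm_nonneg _) (norm_nonneg _), hp2, hq2]
    linarith
  have hx'le : ‖x'‖ ≤ ‖q‖ := by
    rw [← sq_le_sq₀ (norm_nonneg _) (norm_nonneg _), hq2]
    nlinarith [sq_nonneg ‖y‖]
  -- The minimality of `y` in `ℓ¹` norm bounds the part of `x` outside the support of `y`.
  have hcone : ∑ i ∈ Sᶜ, ‖x i‖ ≤ √k * ‖p‖ := by
    have h1 : l1Norm x.ofLp = ∑ i ∈ S, ‖x i‖ + ∑ i ∈ Sᶜ, ‖x i‖ :=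
      (Finset.sum_add_sum_compl S _).symm
    have h2 : l1Norm y.ofLp = ∑ i ∈ S, ‖y i‖ :=
      (Finset.sum_subset (Finset.subset_univ S) fun i _ hi => by rw [hyS i hi, norm_zero]).symm
    have h3 : ∑ i ∈ S, ‖y i‖ ≤ ∑ i ∈ S, ‖x i‖ + ∑ i ∈ S, ‖p i‖ := by
      rw [← Finset.sum_add_distrib]
      refine Finset.sum_le_sum fun i hi => ?_
      have : y i = x i - p i := by rw [hp, PiLp.sub_apply, hx'S i hi]; ring
      rw [this]
      exact norm_sub_le _ _
    have h4 := sum_norm_le_sqrt_card_mul_norm S p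
    have h5 : √(S.card : ℝ) * ‖p‖ ≤ √k * ‖p‖ := by gcongr
    linarith
  have hLt : ‖L t‖ ≤ κ * (δ * ‖p‖) := by
    refine htail.trans ?_
    gcongr
    calc (∑ i ∈ Sᶜ, ‖x i‖) / √s ≤ (√k * ‖p‖) / √s := by gcongr
      _ = √k / √s * ‖p‖ := by ring
      _ ≤ δ * ‖p‖ := by gcongr
  have hLx' : ‖L x'‖ ≤ κ * ‖x'‖ := hL.norm_le _ x' hcard hx'0
  have hlow := hL.le_sum _ p q hcard hp0 hq0 hpq
  -- `|L x| = |L y|` lets the difference of intensities of `x'` and `y` be read off from `t`.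
  have hsum : ∑ j, |((starRingEnd ℂ (L p j)) * L q j).re| =
      ∑ j, |((starRingEnd ℂ (L t j)) * (L x' + L x' + L t) j).re| := by
    refine Finset.sum_congr rfl fun j _ => ?_
    have h1 : ‖(L x' + L t) j‖ ^ 2 = ‖L y j‖ ^ 2 := by
      rw [← map_add, ← hsplit, hxy j]
    rw [hp, hq, map_sub, map_add, ← abs_neg]
    congr 1
    rw [PiLp.add_apply, Complex.sq_norm, Complex.sq_norm, Complex.normSq_apply,
      Complex.normSq_apply] at h1
    simp only [PiLp.add_apply, PiLp.sub_apply, Complex.mul_re, Complex.conj_re, Complex.conj_im,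
      Complex.add_re, Complex.add_im, Complex.sub_re, Complex.sub_im, map_sub] at h1 ⊢
    linarith
  have hup : c * (‖p‖ * ‖q‖) ≤ κ ^ 2 * δ * (2 + δ) * (‖p‖ * ‖q‖) := by
    rw [hsum] at hlow
    refine hlow.trans ((sum_abs_re_conj_mul_le _ _).trans ?_)
    have h1 : ‖L x' + L x' + L t‖ ≤ κ * ((2 + δ) * ‖q‖) := by
      refine (norm_add₃_le).trans ?_
      have e1 : κ * ‖x'‖ ≤ κ * ‖q‖ := by gcongr
      have e2 : κ * (δ * ‖p‖) ≤ κ * (δ * ‖q‖) := by gcongr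
      linarith
    calc ‖L t‖ * ‖L x' + L x' + L t‖ ≤ (κ * (δ * ‖p‖)) * (κ * ((2 + δ) * ‖q‖)) := by gcongr
      _ = _ := by ring
  have hzero : ‖p‖ * ‖q‖ = 0 := by
    have : 0 ≤ ‖p‖ * ‖q‖ := by positivity
    nlinarith
  have hpz : ‖p‖ = 0 := by
    rcases mul_eq_zero.1 hzero with h | h
    · exact h
    · exact le_antisymm (h ▸ hple) (norm_nonneg _)
  have hxS : ∀ i ∈ Sᶜ, ‖x i‖ = 0 := by
    rw [hpz, mul_zero] at hcone
    exact (Finset.sum_eq_zero_iff_of_nonneg fun i _ => norm_nonneg _).1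
      (le_antisymm hcone (Finset.sum_nonneg fun i _ => norm_nonneg _))
  have hx'y : x' = y := sub_eq_zero.1 (norm_eq_zero.1 hpz)
  ext i
  by_cases hi : i ∈ S
  · rw [← hx'S i hi, hx'y]
  · rw [hyS i hi, norm_eq_zero.1 (hxS i (Finset.mem_compl.2 hi))]

theorem l1Norm_smul {n : ℕ} (c : ℂ) (x : Fin n → ℂ) : l1Norm (c • x) = ‖c‖ * l1Norm x := by
  simp [l1Norm, Finset.mul_sum]

theorem exists_phase_aligned (z : ℂ) : ∃ c : ℂ, ‖c‖ = 1 ∧ (c * z).im = 0 ∧ 0 ≤ (c * z).re := by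
  by_cases hz : z = 0
  · exact ⟨1, by simp [hz]⟩
  · have hn : (‖z‖ : ℂ) ≠ 0 := by simpa using hz
    have h : starRingEnd ℂ z / ‖z‖ * z = (‖z‖ : ℂ) := by
      rw [div_mul_eq_mul_div, Complex.conj_mul', sq, mul_div_assoc, div_self hn, mul_one]
    refine ⟨starRingEnd ℂ z / ‖z‖, ?_, ?_, ?_⟩
    · simp [hz]
    · rw [h, Complex.ofReal_im]
    · rw [h, Complex.ofReal_re]; exact norm_nonneg _

/-- Aligning phases reduces a general competitor to `SeparatesSparse.eq_of_aligned`. -/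
theorem SeparatesSparse.l1Minimizers_eq {m n k s : ℕ} {A : Matrix (Fin m) (Fin n) ℂ} {κ c δ : ℝ}
    (hA : SeparatesSparse (Matrix.toEuclideanLin A) (k + s) κ c) (hs : 1 ≤ s) (hκ : 0 ≤ κ)
    (hδ : √k / √s ≤ δ) (hc : κ ^ 2 * δ * (2 + δ) < c) {x₀ : Fin n → ℂ} (hx₀ : IsSparse k x₀) :
    l1Minimizers A x₀ = phaseOrbit x₀ := by
  have key : ∀ x ∈ phaselessFeasible A x₀, l1Norm x ≤ l1Norm x₀ → x ∈ phaseOrbit x₀ := by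
    intro x hx hl
    obtain ⟨c, hc1, him, hre⟩ :=
      exists_phase_aligned (inner ℂ (WithLp.toLp 2 x₀) (WithLp.toLp 2 x))
    have hc0 : c ≠ 0 := fun h => by simp [h] at hc1
    have h := hA.eq_of_aligned hs hκ hδ hc (x := c • WithLp.toLp 2 x) (y := WithLp.toLp 2 x₀)
      hx₀ (fun j => by
        rw [map_smul, PiLp.smul_apply, norm_smul, hc1, one_mul]
        simpa using hx j)
      (by
        rw [WithLp.ofLp_smul, l1Norm_smul, hc1, one_mul]
        exact hl)
      (by rwa [inner_smul_right]) (by rwa [inner_smul_right])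
    refine ⟨c⁻¹, by simp [hc1], ?_⟩
    have h' : c • x = x₀ := congrArg WithLp.ofLp h
    rw [← h', smul_smul, inv_mul_cancel₀ hc0, one_smul]
  have hself : x₀ ∈ phaselessFeasible A x₀ := fun _ => rfl
  ext x
  constructor
  · rintro ⟨hx, hmin⟩
    exact key x hx (hmin x₀ hself)
  · rintro ⟨c, hc1, rfl⟩
    refine ⟨fun j => ?_, fun y hy => ?_⟩
    · rw [Matrix.mulVec_smul, Pi.smul_apply, norm_smul, hc1, one_mul]
    · rw [l1Norm_smul, hc1, one_mul]
      by_contra! hlt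
      obtain ⟨d, hd1, rfl⟩ := key y hy hlt.le
      rw [l1Norm_smul, hd1, one_mul] at hlt
      exact lt_irrefl _ hlt

/-! ### From nets to all sparse vectors -/

/-- A linear map that is bounded by `b` on a `1 / 2`-net of the vectors of the unit ball supported
in `T` is bounded by `2 b` on all vectors supported in `T`. -/
theorem norm_map_le_of_net {n : ℕ} {F : Type*} [NormedAddCommGroup F] [NormedSpace ℂ F]
    (L : EuclideanSpace ℂ (Fin n) →ₗ[ℂ] F) {T : Finset (Fin n)}
    {N : Set (EuclideanSpace ℂ (Fin n))} {b : ℝ} (hN0 : ∀ y ∈ N, ∀ i ∉ T, y i = 0)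
    (hnet : ∀ x : EuclideanSpace ℂ (Fin n), (∀ i ∉ T, x i = 0) → ‖x‖ ≤ 1 →
      ∃ y ∈ N, ‖x - y‖ ≤ 1 / 2)
    (hb : ∀ y ∈ N, ‖L y‖ ≤ b) {x : EuclideanSpace ℂ (Fin n)} (hx : ∀ i ∉ T, x i = 0) :
    ‖L x‖ ≤ 2 * b * ‖x‖ := by
  let V : Set ℝ := {r | ∃ x : EuclideanSpace ℂ (Fin n), (∀ i ∉ T, x i = 0) ∧ ‖x‖ ≤ 1 ∧ r = ‖L x‖}
  have hbdd : BddAbove V := by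
    refine ⟨‖L.toContinuousLinearMap‖, ?_⟩
    rintro r ⟨x, -, hx1, rfl⟩
    have := L.toContinuousLinearMap.le_opNorm_of_le hx1
    simpa using this
  have hne : V.Nonempty := ⟨‖L 0‖, 0, by simp, by simp, rfl⟩
  have hM : sSup V ≤ b + sSup V / 2 := by
    refine csSup_le hne ?_
    rintro r ⟨x, hx, hx1, rfl⟩
    obtain ⟨y, hy, hxy⟩ := hnet x hx hx1
    have hmem : ‖L ((2 : ℂ) • (x - y))‖ ∈ V := by
      refine ⟨_, fun i hi => ?_, ?_, rfl⟩
      · simp [hx i hi, hN0 y hy i hi]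
      · rw [norm_smul, Complex.norm_ofNat]; linarith
    have h1 := le_csSup hbdd hmem
    rw [map_smul, norm_smul, Complex.norm_ofNat] at h1
    have h2 : ‖L x‖ ≤ ‖L y‖ + ‖L (x - y)‖ := by
      rw [map_sub]; exact norm_le_norm_add_norm_sub' _ _
    linarith [hb y hy]
  have hM' : sSup V ≤ 2 * b := by linarith
  rcases eq_or_ne x 0 with rfl | hx0
  · simp
  have hxn : 0 < ‖x‖ := norm_pos_iff.2 hx0
  have hmem : ‖L ((‖x‖⁻¹ : ℂ) • x)‖ ∈ V := by
    refine ⟨_, fun i hi => by simp [hx i hi], ?_, rfl⟩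
    rw [norm_smul, norm_inv, Complex.norm_real, norm_norm, inv_mul_cancel₀ hxn.ne']
  have h1 := (le_csSup hbdd hmem).trans hM'
  rwa [map_smul, norm_smul, norm_inv, Complex.norm_real, norm_norm, inv_mul_le_iff₀ hxn,
    mul_comm] at h1

/-- The lower bound for the intensities, from a net to all pairs of unit vectors: replacing `p`
and `q` by points of the net changes the sum by at most `2 ε κ²`. -/
theorem le_sum_of_net_of_norm_eq_one {m n : ℕ}
    (L : EuclideanSpace ℂ (Fin n) →ₗ[ℂ] EuclideanSpace ℂ (Fin m)) {T : Finset (Fin n)}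
    {N : Set (EuclideanSpace ℂ (Fin n))} {κ ε b : ℝ} (hε : ε ≤ 1 / 16)
    (hN : ∀ y ∈ N, ‖y‖ ≤ 1 ∧ ∀ i ∉ T, y i = 0)
    (hnet : ∀ x : EuclideanSpace ℂ (Fin n), (∀ i ∉ T, x i = 0) → ‖x‖ ≤ 1 →
      ∃ y ∈ N, ‖x - y‖ ≤ ε)
    (hκ : ∀ x : EuclideanSpace ℂ (Fin n), (∀ i ∉ T, x i = 0) → ‖L x‖ ≤ κ * ‖x‖) (hκ0 : 0 ≤ κ)
    (hb : ∀ p ∈ N, ∀ q ∈ N, 1 / 4 ≤ ‖p‖ ^ 2 * ‖q‖ ^ 2 - (inner ℂ p q).im ^ 2 →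
      b ≤ ∑ j, |((starRingEnd ℂ (L p j)) * L q j).re|)
    {p q : EuclideanSpace ℂ (Fin n)} (hp : ∀ i ∉ T, p i = 0) (hq : ∀ i ∉ T, q i = 0)
    (hp1 : ‖p‖ = 1) (hq1 : ‖q‖ = 1) (hpq : (inner ℂ p q).im = 0) :
    b - 2 * ε * κ ^ 2 ≤ ∑ j, |((starRingEnd ℂ (L p j)) * L q j).re| := by
  obtain ⟨p', hp', hpp'⟩ := hnet p hp hp1.le
  obtain ⟨q', hq', hqq'⟩ := hnet q hq hq1.le
  obtain ⟨hp'1, hp'0⟩ := hN p' hp'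
  obtain ⟨hq'1, hq'0⟩ := hN q' hq'
  rw [norm_sub_rev] at hpp' hqq'
  have hε0 : 0 ≤ ε := (norm_nonneg _).trans hpp'
  have hpn : 1 - ε ≤ ‖p'‖ := by
    have := norm_sub_norm_le p p'
    rw [norm_sub_rev] at this
    linarith
  have hqn : 1 - ε ≤ ‖q'‖ := by
    have := norm_sub_norm_le q q'
    rw [norm_sub_rev] at this
    linarith
  have him : |(inner ℂ p' q').im| ≤ 2 * ε := by
    have e : (inner ℂ p' q').im = (inner ℂ (p' - p) q).im + (inner ℂ p' (q' - q)).im := by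
      rw [inner_sub_left, inner_sub_right, Complex.sub_im, Complex.sub_im, hpq]
      ring
    rw [e]
    refine (abs_add_le _ _).trans ?_
    have h1 := (Complex.abs_im_le_norm (inner ℂ (p' - p) q)).trans (norm_inner_le_norm _ _)
    have h2 := (Complex.abs_im_le_norm (inner ℂ p' (q' - q))).trans (norm_inner_le_norm _ _)
    rw [hq1] at h1
    have h3 : ‖p'‖ * ‖q' - q‖ ≤ 1 * ε := by gcongr
    linarith
  have hcond : 1 / 4 ≤ ‖p'‖ ^ 2 * ‖q'‖ ^ 2 - (inner ℂ p' q').im ^ 2 := by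
    have h1 : (15 / 16 : ℝ) ^ 2 ≤ ‖p'‖ ^ 2 := by gcongr; linarith
    have h2 : (15 / 16 : ℝ) ^ 2 ≤ ‖q'‖ ^ 2 := by gcongr; linarith
    have h3 : (inner ℂ p' q').im ^ 2 ≤ (1 / 8) ^ 2 := by
      rw [← sq_abs]
      gcongr
      linarith
    nlinarith
  have hmain := hb p' hp' q' hq' hcond
  have hterm : ∀ j, |((starRingEnd ℂ (L p' j)) * L q' j).re| ≤
      |((starRingEnd ℂ (L p j)) * L q j).re| + (|((starRingEnd ℂ (L (p' - p) j)) * L q j).re| +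
        |((starRingEnd ℂ (L p' j)) * L (q' - q) j).re|) := by
    intro j
    have e : ((starRingEnd ℂ (L p' j)) * L q' j).re = ((starRingEnd ℂ (L p j)) * L q j).re +
        (((starRingEnd ℂ (L (p' - p) j)) * L q j).re +
          ((starRingEnd ℂ (L p' j)) * L (q' - q) j).re) := by
      simp only [map_sub, PiLp.sub_apply, sub_mul, mul_sub, Complex.sub_re]
      ring
    rw [e]
    exact (abs_add_le _ _).trans (by gcongr; exact abs_add_le _ _)
  have hsum := Finset.sum_le_sum fun j (_ : j ∈ Finset.univ) => hterm j
  rw [Finset.sum_add_distrib, Finset.sum_add_distrib] at hsum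
  have hd1 : ∑ j, |((starRingEnd ℂ (L (p' - p) j)) * L q j).re| ≤ ε * κ ^ 2 := by
    refine (sum_abs_re_conj_mul_le _ _).trans ?_
    have h1 := hκ (p' - p) fun i hi => by simp [hp'0 i hi, hp i hi]
    have h2 := hκ q hq
    calc ‖L (p' - p)‖ * ‖L q‖ ≤ (κ * ‖p' - p‖) * (κ * ‖q‖) := by gcongr
      _ ≤ (κ * ε) * (κ * 1) := by gcongr; exact hq1.le
      _ = ε * κ ^ 2 := by ring
  have hd2 : ∑ j, |((starRingEnd ℂ (L p' j)) * L (q' - q) j).re| ≤ ε * κ ^ 2 := by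
    refine (sum_abs_re_conj_mul_le _ _).trans ?_
    have h1 := hκ (q' - q) fun i hi => by simp [hq'0 i hi, hq i hi]
    have h2 := hκ p' hp'0
    calc ‖L p'‖ * ‖L (q' - q)‖ ≤ (κ * ‖p'‖) * (κ * ‖q' - q‖) := by gcongr
      _ ≤ (κ * 1) * (κ * ε) := by gcongr
      _ = ε * κ ^ 2 := by ring
  linarith

/-- The intensity sum is positively homogeneous, so a lower bound on unit vectors gives one on all
vectors. -/
theorem le_sum_of_unit {m n : ℕ}
    (L : EuclideanSpace ℂ (Fin n) →ₗ[ℂ] EuclideanSpace ℂ (Fin m)) {T : Finset (Fin n)} {b : ℝ}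
    (hb : ∀ p q : EuclideanSpace ℂ (Fin n), (∀ i ∉ T, p i = 0) → (∀ i ∉ T, q i = 0) →
      ‖p‖ = 1 → ‖q‖ = 1 → (inner ℂ p q).im = 0 →
      b ≤ ∑ j, |((starRingEnd ℂ (L p j)) * L q j).re|)
    {p q : EuclideanSpace ℂ (Fin n)} (hp : ∀ i ∉ T, p i = 0) (hq : ∀ i ∉ T, q i = 0)
    (hpq : (inner ℂ p q).im = 0) :
    b * (‖p‖ * ‖q‖) ≤ ∑ j, |((starRingEnd ℂ (L p j)) * L q j).re| := by
  rcases eq_or_ne p 0 with hp0 | hp0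
  · simp [hp0]
  rcases eq_or_ne q 0 with hq0 | hq0
  · simp [hq0]
  have hpn : 0 < ‖p‖ := norm_pos_iff.2 hp0
  have hqn : 0 < ‖q‖ := norm_pos_iff.2 hq0
  have hunit : ∀ z : EuclideanSpace ℂ (Fin n), 0 < ‖z‖ → ‖((‖z‖⁻¹ : ℝ) : ℂ) • z‖ = 1 :=
    fun z hz => by
      rw [norm_smul, Complex.norm_real, norm_inv, norm_norm, inv_mul_cancel₀ hz.ne']
  have h := hb (((‖p‖⁻¹ : ℝ) : ℂ) • p) (((‖q‖⁻¹ : ℝ) : ℂ) • q)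
    (fun i hi => by rw [PiLp.smul_apply, hp i hi, smul_zero])
    (fun i hi => by rw [PiLp.smul_apply, hq i hi, smul_zero]) (hunit p hpn) (hunit q hqn)
    (by rw [inner_smul_left, inner_smul_right, Complex.conj_ofReal, Complex.im_ofReal_mul,
      Complex.im_ofReal_mul, hpq, mul_zero, mul_zero])
  have e : ∀ j, |((starRingEnd ℂ (L (((‖p‖⁻¹ : ℝ) : ℂ) • p) j)) *
      L (((‖q‖⁻¹ : ℝ) : ℂ) • q) j).re| =
      (‖p‖ * ‖q‖)⁻¹ * |((starRingEnd ℂ (L p j)) * L q j).re| := by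
    intro j
    rw [map_smul, map_smul, PiLp.smul_apply, PiLp.smul_apply, smul_eq_mul, smul_eq_mul, map_mul,
      Complex.conj_ofReal, mul_mul_mul_comm, ← Complex.ofReal_mul, Complex.re_ofReal_mul, abs_mul,
      abs_of_pos (by positivity), mul_inv]
  simp_rw [e] at h
  rw [← Finset.mul_sum, le_inv_mul_iff₀ (by positivity)] at h
  linarith

/-- If the measurement map is controlled on a `2⁻²²`-net of the vectors supported in `T`, for every
small support `T`, then it separates sparse vectors. -/
theorem SeparatesSparse.of_nets {m n s : ℕ}
    (L : EuclideanSpace ℂ (Fin n) →ₗ[ℂ] EuclideanSpace ℂ (Fin m))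
    (N : Finset (Fin n) → Finset (EuclideanSpace ℂ (Fin n)))
    (hN : ∀ T, ∀ y ∈ N T, ‖y‖ ≤ 1 ∧ ∀ i ∉ T, y i = 0)
    (hnet : ∀ T, ∀ x : EuclideanSpace ℂ (Fin n), (∀ i ∉ T, x i = 0) → ‖x‖ ≤ 1 →
      ∃ y ∈ N T, ‖x - y‖ ≤ 1 / 2 ^ 22)
    (hup : ∀ T, T.card ≤ s → ∀ y ∈ N T, ‖L y‖ ^ 2 ≤ 8 * m)
    (hlow : ∀ T, T.card ≤ s → ∀ p ∈ N T, ∀ q ∈ N T,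
      1 / 4 ≤ ‖p‖ ^ 2 * ‖q‖ ^ 2 - (inner ℂ p q).im ^ 2 →
      m / 2 ^ 15 ≤ ∑ j, |((starRingEnd ℂ (L p j)) * L q j).re|) :
    SeparatesSparse L s (2 * √(8 * m)) (m / 2 ^ 16) := by
  have hbound : ∀ (T : Finset (Fin n)) (x : EuclideanSpace ℂ (Fin n)), T.card ≤ s →
      (∀ i ∉ T, x i = 0) → ‖L x‖ ≤ 2 * √(8 * m) * ‖x‖ := fun T x hT hx =>
    norm_map_le_of_net L (N := (N T : Set _)) (fun y hy => (hN T y hy).2)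
      (fun z hz hz1 => by
        obtain ⟨y, hy, h⟩ := hnet T z hz hz1
        exact ⟨y, hy, h.trans (by norm_num)⟩)
      (fun y hy => Real.le_sqrt_of_sq_le (hup T hT y hy)) hx
  refine ⟨hbound, fun T p q hT hp hq hpq => le_sum_of_unit L (T := T) ?_ hp hq hpq⟩
  intro p q hp hq hp1 hq1 hpq
  have h := le_sum_of_net_of_norm_eq_one L (N := (N T : Set _)) (by norm_num) (hN T) (hnet T)
    (fun x hx => hbound T x hT hx) (by positivity) (hlow T hT) hp hq hp1 hq1 hpq
  refine le_trans (le_of_eq ?_) h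
  rw [mul_pow, Real.sq_sqrt (by positivity)]
  ring

/-! ### The random measurement map -/

theorem toEuclideanLin_of_apply {m n : ℕ} (v : Fin m → Fin n → ℂ) (x : EuclideanSpace ℂ (Fin n))
    (j : Fin m) : Matrix.toEuclideanLin (Matrix.of v) x j = v j ⬝ᵥ x.ofLp := rfl

section Probability

variable {m n : ℕ} {Ω : Type*} [MeasurableSpace Ω] {P : Measure Ω} {a : Fin m → Ω → (Fin n → ℂ)}

/-- The bad events are written as negations of the hypotheses of `SeparatesSparse.of_nets`, at the
common rate `2⁻²³`. -/
theorem measure_norm_sq_gt_le (ha : ∀ j, HasLaw (a j) (complexGaussian n) P)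
    (hind : iIndepFun a P) {y : EuclideanSpace ℂ (Fin n)} (hy : ‖y‖ ≤ 1) :
    P {ω | ¬ ‖Matrix.toEuclideanLin (Matrix.of fun j => a j ω) y‖ ^ 2 ≤ 8 * m} ≤
      ENNReal.ofReal (Real.exp (-(1 / 2 ^ 23 * m))) := by
  have hm : Measurable fun x : Fin n → ℂ => ‖x ⬝ᵥ y.ofLp‖ ^ 2 / 4 - 2 :=
    (((measurable_dotProduct _).norm.pow_const 2).div_const 4).sub_const 2
  refine (measure_mono fun ω hω => ?_).trans
    ((measure_sum_nonneg_le ha hind hm (lintegral_upper_tail_le hy)).trans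
      (ENNReal.ofReal_le_ofReal (Real.exp_le_exp.2 ?_)))
  · simp only [Set.mem_ofPred_eq, not_le, EuclideanSpace.norm_sq_eq, toEuclideanLin_of_apply]
      at hω ⊢
    rw [Finset.sum_sub_distrib, ← Finset.sum_div, Finset.sum_const, Finset.card_univ,
      Fintype.card_fin, nsmul_eq_mul]
    linarith
  · have : (0 : ℝ) ≤ m := Nat.cast_nonneg m
    linarith

theorem measure_sum_abs_lt_le (ha : ∀ j, HasLaw (a j) (complexGaussian n) P)
    (hind : iIndepFun a P) {p q : EuclideanSpace ℂ (Fin n)} (hp : ‖p‖ ≤ 1) (hq : ‖q‖ ≤ 1)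
    (hpq : 1 / 4 ≤ ‖p‖ ^ 2 * ‖q‖ ^ 2 - (inner ℂ p q).im ^ 2) :
    P {ω | ¬ m / 2 ^ 15 ≤
        ∑ j, |((starRingEnd ℂ (Matrix.toEuclideanLin (Matrix.of fun j => a j ω) p j)) *
          Matrix.toEuclideanLin (Matrix.of fun j => a j ω) q j).re|} ≤
      ENNReal.ofReal (Real.exp (-(1 / 2 ^ 23 * m))) := by
  have hm : Measurable fun x : Fin n → ℂ =>
      1 / 2 ^ 23 - |((starRingEnd ℂ (x ⬝ᵥ p.ofLp)) * (x ⬝ᵥ q.ofLp)).re| / 256 := by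
    unfold dotProduct
    fun_prop
  refine (measure_mono fun ω hω => ?_).trans
    (measure_sum_nonneg_le ha hind hm (lintegral_lower_tail_le hp hq hpq))
  simp only [Set.mem_ofPred_eq, not_le, toEuclideanLin_of_apply] at hω ⊢
  rw [Finset.sum_sub_distrib, Finset.sum_const, Finset.card_univ, Fintype.card_fin, nsmul_eq_mul,
    ← Finset.sum_div]
  linarith

/-- The union bound over all small supports `T` and all points and pairs of points of the nets. -/
theorem measure_not_separatesSparse_le (ha : ∀ j, HasLaw (a j) (complexGaussian n) P)
    (hind : iIndepFun a P) {k s : ℕ} (hk : 1 ≤ k) (hkn : k ≤ n) (hks : k ≤ s) :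
    P {ω | ¬ SeparatesSparse (Matrix.toEuclideanLin (Matrix.of fun j => a j ω)) s
        (2 * √(8 * m)) (m / 2 ^ 16)} ≤
      ENNReal.ofReal (2 * Real.exp (s * Real.log (Real.exp 1 * n / k) + 96 * s -
        1 / 2 ^ 23 * m)) := by
  classical
  choose N hcard hN hnet using fun T : Finset (Fin n) =>
    exists_net_supported T (ε := 1 / 2 ^ 22) (by norm_num)
  set L : Ω → EuclideanSpace ℂ (Fin n) →ₗ[ℂ] EuclideanSpace ℂ (Fin m) :=
    fun ω => Matrix.toEuclideanLin (Matrix.of fun j => a j ω)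
  set 𝒯 := (Finset.univ : Finset (Finset (Fin n))).filter fun T => T.card ≤ s with h𝒯
  set W : Finset (Fin n) → Finset (EuclideanSpace ℂ (Fin n) × EuclideanSpace ℂ (Fin n)) :=
    fun T => (N T ×ˢ N T).filter fun z =>
      1 / 4 ≤ ‖z.1‖ ^ 2 * ‖z.2‖ ^ 2 - (inner ℂ z.1 z.2).im ^ 2 with hW
  set r : ℝ := Real.exp (-(1 / 2 ^ 23 * m)) with hr
  set B : ℝ := Real.exp (96 * s) with hB
  -- The number of points of a net, and of pairs of such points, is at most `B`.
  have hN2 : ∀ T ∈ 𝒯, ((N T).card : ℝ) ≤ B ∧ ((N T).card : ℝ) ^ 2 ≤ B := by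
    intro T hT
    have hTs : T.card ≤ s := (Finset.mem_filter.1 hT).2
    have h2e : (2 : ℝ) ≤ Real.exp 1 := by linarith [Real.add_one_le_exp 1]
    have h0 : ((N T).card : ℝ) ≤ Real.exp (48 * s) := by
      calc ((N T).card : ℝ) ≤ (1 + 2 / (1 / 2 ^ 22)) ^ (2 * T.card) := hcard T
        _ ≤ (2 ^ 24) ^ (2 * s) := by
          refine (pow_le_pow_left₀ (by positivity) (by norm_num) _).trans
            (pow_le_pow_right₀ (by norm_num) (by omega))
        _ = 2 ^ (48 * s) := by rw [← pow_mul]; congr 1; ring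
        _ ≤ Real.exp 1 ^ (48 * s) := by gcongr
        _ = Real.exp (48 * s) := by
          rw [← Real.exp_nat_mul, mul_one]; push_cast; rfl
    constructor
    · refine h0.trans (Real.exp_le_exp.2 ?_)
      have : (0 : ℝ) ≤ s := Nat.cast_nonneg s
      linarith
    · calc ((N T).card : ℝ) ^ 2 ≤ Real.exp (48 * s) ^ 2 := by gcongr
        _ = B := by rw [← Real.exp_nat_mul, hB]; congr 1; push_cast; ring
  have hsub : {ω | ¬ SeparatesSparse (L ω) s (2 * √(8 * m)) (m / 2 ^ 16)} ⊆
      ⋃ T ∈ 𝒯, ((⋃ y ∈ N T, {ω | ¬ ‖L ω y‖ ^ 2 ≤ 8 * m}) ∪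
        ⋃ z ∈ W T, {ω | ¬ m / 2 ^ 15 ≤
          ∑ j, |((starRingEnd ℂ (L ω z.1 j)) * L ω z.2 j).re|}) := by
    intro ω hω
    by_contra hgood
    refine hω (SeparatesSparse.of_nets (L ω) N hN hnet ?_ ?_)
    · intro T hT y hy
      by_contra hbad
      refine hgood (Set.mem_biUnion (show T ∈ 𝒯 by simp [h𝒯, hT]) (Or.inl ?_))
      exact Set.mem_biUnion hy hbad
    · intro T hT p hp q hq hpq
      by_contra hbad
      refine hgood (Set.mem_biUnion (show T ∈ 𝒯 by simp [h𝒯, hT]) (Or.inr ?_))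
      exact Set.mem_biUnion (show (p, q) ∈ W T from
        Finset.mem_filter.2 ⟨Finset.mem_product.2 ⟨hp, hq⟩, hpq⟩) hbad
  have hnat : ∀ {c : ℕ} {b x : ℝ}, (c : ℝ) ≤ b → 0 ≤ x →
      c • ENNReal.ofReal x ≤ ENNReal.ofReal (b * x) := by
    intro c b x hc hx
    rw [nsmul_eq_mul, ← ENNReal.ofReal_natCast, ← ENNReal.ofReal_mul (Nat.cast_nonneg c)]
    exact ENNReal.ofReal_le_ofReal (mul_le_mul_of_nonneg_right hc hx)
  have hr0 : 0 ≤ r := (Real.exp_pos _).le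
  have hB0 : 0 ≤ B := (Real.exp_pos _).le
  have hT : ∀ T ∈ 𝒯, P ((⋃ y ∈ N T, {ω | ¬ ‖L ω y‖ ^ 2 ≤ 8 * m}) ∪
        ⋃ z ∈ W T, {ω | ¬ m / 2 ^ 15 ≤
          ∑ j, |((starRingEnd ℂ (L ω z.1 j)) * L ω z.2 j).re|}) ≤
      ENNReal.ofReal (2 * (B * r)) := by
    intro T hT
    rw [two_mul, ENNReal.ofReal_add (by positivity) (by positivity)]
    refine (measure_union_le _ _).trans (add_le_add ?_ ?_)
    · refine (measure_biUnion_finset_le _ _).trans ((Finset.sum_le_card_nsmul _ _ _ fun y hy =>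
        measure_norm_sq_gt_le ha hind (hN T y hy).1).trans (hnat (hN2 T hT).1 hr0))
    · refine (measure_biUnion_finset_le _ _).trans ((Finset.sum_le_card_nsmul _ _ _
        fun z hz => ?_).trans (hnat ?_ hr0))
      · obtain ⟨hz1, hz2⟩ := Finset.mem_filter.1 hz
        obtain ⟨hz3, hz4⟩ := Finset.mem_product.1 hz1
        exact measure_sum_abs_lt_le ha hind (hN T _ hz3).1 (hN T _ hz4).1 hz2
      · refine le_trans ?_ (hN2 T hT).2
        have : (W T).card ≤ (N T).card ^ 2 := by
          refine (Finset.card_filter_le _ _).trans ?_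
          rw [Finset.card_product, sq]
        exact_mod_cast this
  refine (measure_mono hsub).trans ((measure_biUnion_finset_le _ _).trans
    ((Finset.sum_le_card_nsmul _ _ _ hT).trans
      ((hnat (card_supports_le hk hkn hks) (by positivity)).trans (le_of_eq ?_))))
  congr 1
  rw [hB, hr, ← Real.exp_add, mul_left_comm, ← Real.exp_add]
  congr 2
  ring

end Probability

/-! ### Recovery with high probability -/

theorem mainTheorem3 :
    ∃ C : ℝ, 0 < C ∧ ∃ c₀ : ℝ, 0 < c₀ ∧
      ∀ (n k m : ℕ), 1 ≤ k → k ≤ n →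
        C * ((k : ℝ) * Real.log (Real.exp 1 * (n : ℝ) / (k : ℝ))) ≤ (m : ℝ) →
        ∀ x₀ : Fin n → ℂ, IsSparse k x₀ →
        ∀ (Ω : Type*) [MeasurableSpace Ω] (P : Measure Ω) [IsProbabilityMeasure P]
          (a : Fin m → Ω → (Fin n → ℂ)),
          (∀ j, HasLaw (a j) (complexGaussian n) P) → iIndepFun a P →
          ENNReal.ofReal (1 - 2 * Real.exp (-(c₀ * (m : ℝ)))) ≤
            P {ω | l1Minimizers (Matrix.of fun j => a j ω) x₀ = phaseOrbit x₀} := by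
  -- Blocks have size `s = 2⁴⁶ k`, so supports have size at most `k + s ≤ 2⁴⁷ k`, and the union
  -- bound costs at most `exp (97 * 2⁴⁷ k log (e n / k))`, half of the exponent `2⁻²³ m`.
  refine ⟨97 * 2 ^ 71, by norm_num, 1 / 2 ^ 24, by norm_num, ?_⟩
  intro n k m hk hkn hm x₀ hx₀ Ω _ P _ a ha hind
  have hk0 : (1 : ℝ) ≤ k := by exact_mod_cast hk
  have hkn' : (k : ℝ) ≤ n := by exact_mod_cast hkn
  set Λ := Real.log (Real.exp 1 * (n : ℝ) / (k : ℝ)) with hΛ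
  have hΛ1 : 1 ≤ Λ := by
    rw [hΛ, Real.le_log_iff_exp_le (by have := hk0.trans hkn'; positivity), le_div_iff₀ (by positivity)]
    gcongr
  have hkΛ : 1 ≤ (k : ℝ) * Λ := by nlinarith
  have hm0 : (0 : ℝ) < m := by linarith
  have hs : 1 ≤ 2 ^ 46 * k := by omega
  have hδ : √(k : ℝ) / √((2 ^ 46 * k : ℕ) : ℝ) ≤ 1 / 2 ^ 23 := by
    rw [Nat.cast_mul, Real.sqrt_mul (by positivity),
      show ((2 ^ 46 : ℕ) : ℝ) = (2 ^ 23) ^ 2 by norm_num, Real.sqrt_sq (by positivity),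
      div_le_div_iff₀ (by positivity) (by positivity)]
    linarith
  have hc : (2 * √(8 * m)) ^ 2 * (1 / 2 ^ 23) * (2 + 1 / 2 ^ 23) < (m : ℝ) / 2 ^ 16 := by
    rw [mul_pow, Real.sq_sqrt (by positivity)]
    linarith
  have hbad : P {ω | ¬ l1Minimizers (Matrix.of fun j => a j ω) x₀ = phaseOrbit x₀} ≤
      ENNReal.ofReal (2 * Real.exp (-(1 / 2 ^ 24 * (m : ℝ)))) := by
    refine (measure_mono fun ω hω => ?_).trans
      ((measure_not_separatesSparse_le ha hind hk hkn
        (s := k + 2 ^ 46 * k) (Nat.le_add_right _ _)).trans (ENNReal.ofReal_le_ofReal ?_))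
    · exact fun hsep => hω (hsep.l1Minimizers_eq hs (by positivity) hδ hc hx₀)
    · gcongr
      rw [← hΛ]
      push_cast
      nlinarith
  have huniv : (1 : ENNReal) ≤
      P {ω | l1Minimizers (Matrix.of fun j => a j ω) x₀ = phaseOrbit x₀} +
        P {ω | ¬ l1Minimizers (Matrix.of fun j => a j ω) x₀ = phaseOrbit x₀} := by
    rw [← measure_univ (μ := P)]
    refine (measure_mono fun ω _ => ?_).trans (measure_union_le _ _)
    exact em _
  rw [ENNReal.ofReal_sub _ (by positivity), ENNReal.ofReal_one, tsub_le_iff_right]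
  exact huniv.trans (by gcongr)
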